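/- All $C^*$-algebras are unital and $\otimes$ denotes the minimal tensor product. Let $(A,\Delta)$ be a compact quantum group: $A$ is a unital $C^*$-algebra and $\Delta:A\to A\otimes A$ is a unital $*$-homomorphism with $(\Delta\otimes\mathrm{id})\Delta=(\mathrm{id}\otimes\Delta)\Delta$ such that the linear spans of $\Delta(A)(1\otimes A)$ and of $\Delta(A)(A\otimes 1)$ are dense in $A\otimes A$. Let $\alpha$ be an action of $(A,\Delta)$ on a nonzero unital $C^*$-algebra $B$: $\alpha:B\to B\otimes A$ is a unital $*$-homomorphism with $(\alpha\otimes\mathrm{id})\alpha=(\mathrm{id}\otimes\Delta)\alpha$ such that the linear span of $\alpha(B)(1\otimes A)$ is dense in $B\otimes A$. Put $B^\alpha=\{b\in B:\alpha(b)=b\otimes 1_A\}$. A bounded linear functional $\mu$ on $B$ is called invariant if $(\mu\otimes\mathrm{id})\alpha(b)=\mu(b)1_A$ for all $b\in B$; let $\mathrm{Inv}(B)$ be the space of these functionals, with the norm of the dual space of $B$. The action is called ergodic if $B^\alpha=\mathbb{C}1_B$. 1. The linear map $T:\mathrm{Inv}(B)\to(B^\alpha)'$, $T(\psi)=\psi|_{B^\alpha}$,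 into the dual Banach space of $B^\alpha$ is a bijective isometry. 2. The action $\alpha$ is ergodic if and only if there is exactly one invariant state on $B$. -/

import Mathlib

noncomputable section

set_option linter.unusedSectionVars false
open scoped ComplexOrder TensorProduct InnerProductSpace ENNReal
open UniformSpace

universe u v w

namespace MinTensor

section DirectSum
variable {A : Type u} [CStarAlgebra A] {ι : Type w} {E : ι → Type v}
  [∀ i, NormedAddCommGroup (E i)] [∀ i, InnerProductSpace ℂ (E i)] [∀ i, CompleteSpace (E i)]

lemma norm_rep_apply_le {H : Type v} [NormedAddCommGroup H] [InnerProductSpace ℂ H]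
    [CompleteSpace H] (π : A →⋆ₐ[ℂ] (H →L[ℂ] H)) (a : A) (x : H) : ‖π a x‖ ≤ ‖a‖ * ‖x‖ :=
  (ContinuousLinearMap.le_opNorm _ _).trans
    (mul_le_mul_of_nonneg_right (NonUnitalStarAlgHom.norm_apply_le π a) (norm_nonneg _))

/-- The operator `⨁ π i a` on the Hilbert direct sum. -/
def directSumOp (π : ∀ i, A →⋆ₐ[ℂ] (E i →L[ℂ] E i)) (a : A) : lp E 2 →L[ℂ] lp E 2 :=
  LinearMap.mkContinuous
    { toFun := fun x =>
        (⟨fun i => π i a (x i), ((lp.memℓp x).norm.const_mul ‖a‖).mono fun i => by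
            simpa using norm_rep_apply_le (π i) a (x i)⟩ : lp E 2)
      map_add' := fun x y => by ext f; exact map_add (π f a) _ _
      map_smul' := fun c x => by ext f; exact map_smul (π f a) _ _ } ‖a‖ fun x => by
    have h : ‖(‖a‖ : ℂ) • x‖ = ‖a‖ * ‖x‖ := by rw [norm_smul]; simp
    rw [← h]
    refine lp.norm_mono (by norm_num) fun i => ?_
    rw [lp.coeFn_smul, Pi.smul_apply, norm_smul]
    simpa using norm_rep_apply_le (π i) a (x i)

@[simp] lemma directSumOp_apply (π : ∀ i, A →⋆ₐ[ℂ] (E i →L[ℂ] E i)) (a : A) (x : lp E 2) (i : ι) :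
    directSumOp π a x i = π i a (x i) := rfl

/-- The Hilbert direct sum of a family of representations. -/
def directSumRep (π : ∀ i, A →⋆ₐ[ℂ] (E i →L[ℂ] E i)) : A →⋆ₐ[ℂ] (lp E 2 →L[ℂ] lp E 2) where
  toFun := directSumOp π
  map_one' := by ext x i; simp
  map_mul' a b := by ext x i; simp
  map_zero' := by ext x i; simp
  map_add' a b := by ext x i; simp
  commutes' c := by ext x i; simp [Algebra.algebraMap_eq_smul_one]
  map_star' a := by
    refine (ContinuousLinearMap.eq_adjoint_iff _ _).mpr fun x y => ?_
    simp only [lp.inner_eq_tsum, directSumOp_apply, map_star,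
      ContinuousLinearMap.star_eq_adjoint, ContinuousLinearMap.adjoint_inner_left]

end DirectSum

section UniversalRep
variable (A : Type u) [CStarAlgebra A]
attribute [local instance] CStarAlgebra.spectralOrder CStarAlgebra.spectralOrderedRing

/-- The Hilbert space of the universal representation: the direct sum of the GNS spaces of all
positive functionals. -/
def UnivSpace : Type u := lp (fun f : A →ₚ[ℂ] ℂ => f.GNS) 2

instance : NormedAddCommGroup (UnivSpace A) :=
  inferInstanceAs (NormedAddCommGroup (lp (fun f : A →ₚ[ℂ] ℂ => f.GNS) 2))

instance : InnerProductSpace ℂ (UnivSpace A) :=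
  inferInstanceAs (InnerProductSpace ℂ (lp (fun f : A →ₚ[ℂ] ℂ => f.GNS) 2))

instance : CompleteSpace (UnivSpace A) :=
  inferInstanceAs (CompleteSpace (lp (fun f : A →ₚ[ℂ] ℂ => f.GNS) 2))

/-- The universal representation: the direct sum of the GNS representations of all
positive functionals. -/
def univRep : A →⋆ₐ[ℂ] (UnivSpace A →L[ℂ] UnivSpace A) :=
  (directSumRep fun f : A →ₚ[ℂ] ℂ => f.gnsStarAlgHom :
    A →⋆ₐ[ℂ] (lp (fun f : A →ₚ[ℂ] ℂ => f.GNS) 2 →L[ℂ] lp (fun f : A →ₚ[ℂ] ℂ => f.GNS) 2))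

variable {A}

/-- A contractive functional with `g 1 = 1` is positive. -/
lemma nonneg_of_norm_le_one (g : A →L[ℂ] ℂ) (hg : ‖g‖ ≤ 1) (h1 : g 1 = 1) {a : A} (ha : 0 ≤ a) :
    0 ≤ g a := by
  have key : ∀ z : ℂ, ∀ c : A, ‖g c + z‖ ≤ ‖c + z • (1 : A)‖ := fun z c => by
    have := g.le_of_opNorm_le hg (c + z • 1)
    simpa [h1] using this
  have hsa : IsSelfAdjoint a := .of_nonneg ha
  have : Nontrivial A := ⟨1, 0, fun h => by simp [h] at h1⟩
  have him : (g a).im = 0 := by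
    have h2 : ∀ t : ℝ, ((g a).im + t) ^ 2 ≤ ‖a‖ ^ 2 + t ^ 2 := fun t => by
      have h3 := key (Complex.I * t) a
      have h4 : ‖a + (Complex.I * t) • (1 : A)‖ ^ 2 ≤ ‖a‖ ^ 2 + t ^ 2 := by
        rw [sq, ← CStarRing.norm_star_mul_self]
        have e : star (a + (Complex.I * t) • (1 : A)) * (a + (Complex.I * t) • (1 : A))
            = a * a + ((t : ℂ) ^ 2) • (1 : A) := by
          have e1 : star (a + (Complex.I * t) • (1 : A)) = a - (Complex.I * t) • (1 : A) := by
            simp [hsa.star_eq, sub_eq_add_neg]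
          have e2 : (t : ℂ) ^ 2 = -((Complex.I * t) * (Complex.I * t)) := by
            linear_combination ((t : ℂ) ^ 2) * Complex.I_sq
          rw [e1, e2]
          simp only [mul_add, sub_mul, smul_mul_assoc, one_mul, mul_smul_comm, mul_one,
            smul_sub, smul_smul, neg_smul]
          abel
        rw [e]
        refine (norm_add_le _ _).trans (add_le_add ?_ ?_)
        · rw [sq]; exact norm_mul_le _ _
        · rw [norm_smul]
          simp
      have h5 : |(g a + Complex.I * t).im| ≤ ‖a + (Complex.I * t) • (1 : A)‖ :=
        (Complex.abs_im_le_norm _).trans h3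
      have h6 : (g a + Complex.I * t).im = (g a).im + t := by simp
      rw [h6] at h5
      calc ((g a).im + t) ^ 2 = |(g a).im + t| ^ 2 := (sq_abs _).symm
        _ ≤ _ := pow_le_pow_left₀ (abs_nonneg _) h5 2
        _ ≤ _ := h4
    by_contra hne
    have h3 := h2 ((‖a‖ ^ 2 + 1) / (2 * (g a).im))
    have h4 : 2 * (g a).im * ((‖a‖ ^ 2 + 1) / (2 * (g a).im)) = ‖a‖ ^ 2 + 1 := by field_simp
    nlinarith [sq_nonneg (g a).im]
  refine Complex.nonneg_iff.mpr ⟨?_, him.symm⟩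
  have h3 := key (-‖a‖) a
  have h4 : ‖a + (-(‖a‖ : ℂ)) • (1 : A)‖ ≤ ‖a‖ := by
    have h5 : a + (-(‖a‖ : ℂ)) • (1 : A) = -(algebraMap ℝ A ‖a‖ - a) := by
      rw [Algebra.algebraMap_eq_smul_one, neg_smul, Complex.coe_smul]; abel
    have h6 : 0 ≤ algebraMap ℝ A ‖a‖ - a :=
      sub_nonneg.mpr (IsSelfAdjoint.le_algebraMap_norm_self hsa)
    rw [h5, norm_neg, CStarAlgebra.norm_le_iff_le_algebraMap _ (norm_nonneg _) h6]
    exact sub_le_self _ ha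
  have h5 := (Complex.abs_re_le_norm _).trans (h3.trans h4)
  have h6 : (g a + -(‖a‖ : ℂ)).re = (g a).re - ‖a‖ := by simp [sub_eq_add_neg]
  rw [h6] at h5
  linarith [(abs_le.mp h5).1]

lemma exists_functional_ne_zero {a : A} (ha : a ≠ 0) : ∃ f : A →ₚ[ℂ] ℂ, f (star a * a) ≠ 0 := by
  have : Nontrivial A := ⟨a, 0, ha⟩
  set b := star a * a with hb
  have hbn : 0 ≤ b := star_mul_self_nonneg a
  have hbsa : IsSelfAdjoint b := .of_nonneg hbn
  have : IsStarNormal b := hbsa.isStarNormal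
  have hb0 : ‖b‖ ≠ 0 := by
    rw [hb, CStarRing.norm_star_mul_self]
    exact mul_ne_zero (norm_ne_zero_iff.mpr ha) (norm_ne_zero_iff.mpr ha)
  let S := StarAlgebra.elemental ℂ b
  let b' : S := ⟨b, StarAlgebra.elemental.self_mem ℂ b⟩
  have hspec : ∃ z ∈ spectrum ℂ b', z ≠ 0 := by
    by_contra hcon
    push Not at hcon
    have hb'sa : IsSelfAdjoint b' := Subtype.ext hbsa
    have h0 : spectralRadius ℂ b' = 0 := by
      rw [spectralRadius]
      simp only [ENNReal.iSup_eq_zero]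
      intro z hz
      simp [hcon z hz]
    rw [hb'sa.spectralRadius_eq_nnnorm] at h0
    have h1 : ‖b'‖ = 0 := by
      have : ‖b'‖₊ = 0 := by exact_mod_cast h0
      exact congrArg NNReal.toReal this
    exact hb0 h1
  obtain ⟨z, hz, hz0⟩ := hspec
  obtain ⟨χ, hχ⟩ := WeakDual.CharacterSpace.mem_spectrum_iff_exists.mp hz
  have hχ1 : χ 1 = 1 := map_one χ
  let χ' : StrongDual ℂ S := WeakDual.toStrongDual (χ : WeakDual ℂ S)
  have hχn : ‖χ'‖ ≤ 1 := ContinuousLinearMap.opNorm_le_bound _ zero_le_one fun x => by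
    rw [one_mul]
    exact spectrum.norm_le_norm_of_mem (AlgHom.apply_mem_spectrum χ x)
  obtain ⟨g, hg, hgn⟩ := exists_extension_norm_eq (S.toSubalgebra.toSubmodule) χ'
  have hg1 : g 1 = 1 := (hg (1 : S)).trans hχ1
  have hgb : g b = z := (hg b').trans hχ
  refine ⟨PositiveLinearMap.mk₀ (g : A →ₗ[ℂ] ℂ) fun x hx =>
    nonneg_of_norm_le_one g (hgn.trans_le hχn) hg1 hx, ?_⟩
  exact fun h => hz0 (hgb.symm.trans h)

lemma univRep_injective : Function.Injective (univRep A) := by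
  classical
  rw [injective_iff_map_eq_zero]
  intro a ha
  by_contra hne
  obtain ⟨f, hf⟩ := exists_functional_ne_zero hne
  have h1 := congrArg (fun T : lp (fun f : A →ₚ[ℂ] ℂ => f.GNS) 2 →L[ℂ] lp (fun f : A →ₚ[ℂ] ℂ => f.GNS) 2 =>
    T (lp.single 2 f ((f.toPreGNS 1 : f.PreGNS) : f.GNS)) f)
    (show directSumOp (fun f : A →ₚ[ℂ] ℂ => f.gnsStarAlgHom) a = 0 from ha)
  have h2 : ((f.toPreGNS a : f.PreGNS) : f.GNS) = 0 := by
    simpa using h1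
  have h3 : ‖f.toPreGNS a‖ = 0 := by rw [← Completion.norm_coe, h2, norm_zero]
  have h4 := f.preGNS_norm_sq (f.toPreGNS a)
  rw [h3] at h4
  exact hf (by simpa using h4.symm)

end UniversalRep

section Spatial
variable {A : Type*} {B : Type*} [CStarAlgebra A] [CStarAlgebra B]
  {H : Type*} [NormedAddCommGroup H] [InnerProductSpace ℂ H] [CompleteSpace H]
  {K : Type*} [NormedAddCommGroup K] [InnerProductSpace ℂ K] [CompleteSpace K]

/-- The operators `∑ π aᵢ ⊗ σ bᵢ` on the algebraic tensor product `H ⊗ K`. -/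
def tensorOp (π : A →⋆ₐ[ℂ] (H →L[ℂ] H)) (σ : B →⋆ₐ[ℂ] (K →L[ℂ] K)) :
    A ⊗[ℂ] B →ₗ[ℂ] (H ⊗[ℂ] K →L[ℂ] H ⊗[ℂ] K) :=
  TensorProduct.lift <| LinearMap.mk₂ ℂ (fun a b => TensorProduct.mapL (π a) (σ b))
    (fun a a' b => by rw [map_add, TensorProduct.mapL_add_left])
    (fun c a b => by rw [map_smul, TensorProduct.mapL_smul_left])
    (fun a b b' => by rw [map_add, TensorProduct.mapL_add_right])
    (fun c a b => by rw [map_smul, TensorProduct.mapL_smul_right])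

variable (π : A →⋆ₐ[ℂ] (H →L[ℂ] H)) (σ : B →⋆ₐ[ℂ] (K →L[ℂ] K))

@[simp] lemma tensorOp_tmul (a : A) (b : B) (h : H) (k : K) :
    tensorOp π σ (a ⊗ₜ b) (h ⊗ₜ k) = π a h ⊗ₜ σ b k := rfl

lemma tensorOp_one : tensorOp π σ 1 = 1 := by
  rw [Algebra.TensorProduct.one_def]
  ext x
  induction x with
  | zero => simp
  | add x y hx hy => simp only [map_add, hx, hy]
  | tmul h k => simp

lemma tensorOp_mul (x y : A ⊗[ℂ] B) :
    tensorOp π σ (x * y) = tensorOp π σ x * tensorOp π σ y := by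
  induction x with
  | zero => simp
  | add x x' hx hx' => simp only [add_mul, map_add, hx, hx']
  | tmul a b =>
    induction y with
    | zero => simp
    | add y y' hy hy' => simp only [mul_add, map_add, hy, hy']
    | tmul a' b' =>
      ext x
      induction x with
      | zero => simp
      | add x y hx hy => simp only [map_add, hx, hy]
      | tmul h k => simp

lemma tensorOp_star (x : A ⊗[ℂ] B) (ξ η : H ⊗[ℂ] K) :
    ⟪tensorOp π σ (star x) ξ, η⟫_ℂ = ⟪ξ, tensorOp π σ x η⟫_ℂ := by
  induction x with
  | zero => simp
  | add x x' hx hx' =>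
    simp only [star_add, map_add, add_apply, inner_add_left, inner_add_right,
      hx, hx']
  | tmul a b =>
    induction ξ with
    | zero => simp
    | add ξ ξ' h h' => simp only [map_add, inner_add_left, h, h']
    | tmul h k =>
      induction η with
      | zero => simp
      | add ξ ξ' h h' => simp only [map_add, inner_add_right, h, h']
      | tmul h' k' =>
        rw [TensorProduct.star_tmul, tensorOp_tmul, tensorOp_tmul, TensorProduct.inner_tmul,
          TensorProduct.inner_tmul, map_star, map_star, ContinuousLinearMap.star_eq_adjoint,
          ContinuousLinearMap.star_eq_adjoint, ContinuousLinearMap.adjoint_inner_left,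
          ContinuousLinearMap.adjoint_inner_left]

/-- The representation `π ⊗ σ` of the algebraic tensor product on the Hilbert space tensor
product, the completion of `H ⊗ K`. -/
def tensorRep : A ⊗[ℂ] B →⋆ₐ[ℂ] (Completion (H ⊗[ℂ] K) →L[ℂ] Completion (H ⊗[ℂ] K)) where
  toFun x := (tensorOp π σ x).completion
  map_one' := by
    ext ξ
    induction ξ using Completion.induction_on with
    | hp => apply isClosed_eq <;> fun_prop
    | ih ξ => simp [tensorOp_one]
  map_mul' x y := by
    ext ξ
    induction ξ using Completion.induction_on with
    | hp => apply isClosed_eq <;> fun_prop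
    | ih ξ => simp [tensorOp_mul]
  map_zero' := by
    ext ξ
    induction ξ using Completion.induction_on with
    | hp => apply isClosed_eq <;> fun_prop
    | ih ξ => simp
  map_add' x y := by
    ext ξ
    induction ξ using Completion.induction_on with
    | hp => apply isClosed_eq <;> fun_prop
    | ih ξ => simp [Completion.coe_add]
  commutes' c := by
    ext ξ
    induction ξ using Completion.induction_on with
    | hp => apply isClosed_eq <;> fun_prop
    | ih ξ => simp [Algebra.algebraMap_eq_smul_one, tensorOp_one, Completion.coe_smul]
  map_star' x := by
    refine (ContinuousLinearMap.eq_adjoint_iff _ _).mpr fun ξ η => ?_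
    induction ξ, η using Completion.induction_on₂ with
    | hp => apply isClosed_eq <;> fun_prop
    | ih ξ η => simp [tensorOp_star]

@[simp] lemma tensorRep_coe (x : A ⊗[ℂ] B) (ξ : H ⊗[ℂ] K) :
    tensorRep π σ x (ξ : Completion (H ⊗[ℂ] K)) = (tensorOp π σ x ξ : H ⊗[ℂ] K) :=
  ContinuousLinearMap.completion_apply_coe _ _

lemma norm_tensorRep (x : A ⊗[ℂ] B) : ‖tensorRep π σ x‖ = ‖tensorOp π σ x‖ := by
  refine le_antisymm (ContinuousLinearMap.opNorm_le_bound _ (ContinuousLinearMap.opNorm_nonneg _) fun ξ => ?_)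
    (ContinuousLinearMap.opNorm_le_bound _ (ContinuousLinearMap.opNorm_nonneg _) fun ξ => ?_)
  · induction ξ using Completion.induction_on with
    | hp => apply isClosed_le <;> fun_prop
    | ih ξ =>
      rw [tensorRep_coe, Completion.norm_coe, Completion.norm_coe]
      exact ContinuousLinearMap.le_opNorm _ _
  · have := (tensorRep π σ x).le_opNorm (ξ : Completion (H ⊗[ℂ] K))
    rwa [tensorRep_coe, Completion.norm_coe, Completion.norm_coe] at this

end Spatial

section MatrixRep
variable {B : Type*} [CStarAlgebra B]
  {K : Type*} [NormedAddCommGroup K] [InnerProductSpace ℂ K] [CompleteSpace K]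

/-- The entrywise action of matrices over `B` on `Kⁿ` through a representation of `B` on `K`. -/
def matrixRep (σ : B →⋆ₐ[ℂ] (K →L[ℂ] K)) (n : ℕ) :
    CStarMatrix (Fin n) (Fin n) B →⋆ₙₐ[ℂ]
      (PiLp 2 (fun _ : Fin n => K) →L[ℂ] PiLp 2 (fun _ : Fin n => K)) where
  toFun M := (PiLp.continuousLinearEquiv 2 ℂ (fun _ : Fin n => K)).symm.toContinuousLinearMap ∘L
    (ContinuousLinearMap.pi fun i => ∑ j, (σ (M i j)) ∘L PiLp.proj 2 (fun _ : Fin n => K) j)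
  map_smul' c M := by ext v i; simp [Finset.smul_sum]
  map_zero' := by ext v i; simp
  map_add' M N := by ext v i; simp [Finset.sum_add_distrib]
  map_mul' M N := by
    ext v i
    simp only [CStarMatrix.mul_apply]
    simp only [map_sum, map_mul]
    simpa using Finset.sum_comm
  map_star' M := by
    refine (ContinuousLinearMap.eq_adjoint_iff _ _).mpr fun v w => ?_
    simp only [PiLp.inner_apply, CStarMatrix.star_apply]
    simp only [ContinuousLinearMap.coe_comp, Function.comp_apply,
      ContinuousLinearEquiv.coe_coe, PiLp.continuousLinearEquiv_symm_apply,
      ContinuousLinearMap.coe_pi', sum_apply, PiLp.proj_apply, sum_inner, inner_sum,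
      map_star, ContinuousLinearMap.star_eq_adjoint, ContinuousLinearMap.adjoint_inner_left]
    exact Finset.sum_comm

lemma matrixRep_apply (σ : B →⋆ₐ[ℂ] (K →L[ℂ] K)) (n : ℕ) (M : CStarMatrix (Fin n) (Fin n) B)
    (v : PiLp 2 (fun _ : Fin n => K)) (i : Fin n) :
    matrixRep σ n M v i = ∑ j, σ (M i j) (v j) := by
  simp [matrixRep]

lemma matrixRep_injective {σ : B →⋆ₐ[ℂ] (K →L[ℂ] K)} (hσ : Function.Injective σ) (n : ℕ) :
    Function.Injective (matrixRep σ n) := by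
  classical
  rw [injective_iff_map_eq_zero]
  intro M hM
  ext i j
  rw [CStarMatrix.zero_apply]
  refine hσ ?_
  rw [map_zero]
  ext k
  have h := congrArg (fun T : PiLp 2 (fun _ : Fin n => K) →L[ℂ] PiLp 2 (fun _ : Fin n => K) =>
    T (WithLp.toLp 2 (Pi.single j k)) i) hM
  simp only [matrixRep_apply] at h
  rw [Finset.sum_eq_single j (fun l _ hl => by simp [hl]) (by simp)] at h
  simpa using h

end MatrixRep

section Slice
variable {A : Type*} {B : Type*} [CStarAlgebra A] [CStarAlgebra B]
  {H : Type*} [NormedAddCommGroup H] [InnerProductSpace ℂ H] [CompleteSpace H]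
  {K : Type*} [NormedAddCommGroup K] [InnerProductSpace ℂ K] [CompleteSpace K]

/-- The slice map `a ⊗ b ↦ μ a • b` on the algebraic tensor product. -/
def algSliceLeft (B : Type*) [CStarAlgebra B] (μ : A →ₗ[ℂ] ℂ) : A ⊗[ℂ] B →ₗ[ℂ] B :=
  (TensorProduct.lid ℂ B).toLinearMap ∘ₗ μ.rTensor B

@[simp] lemma algSliceLeft_tmul (μ : A →ₗ[ℂ] ℂ) (a : A) (b : B) :
    algSliceLeft B μ (a ⊗ₜ b) = μ a • b := by
  simp [algSliceLeft]

/-- The vector functional `a ↦ ⟪h, π a h'⟫`. -/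
def vecFun (π : A →⋆ₐ[ℂ] (H →L[ℂ] H)) (h h' : H) : A →ₗ[ℂ] ℂ :=
  (innerSL ℂ h).toLinearMap ∘ₗ (ContinuousLinearMap.apply ℂ H h').toLinearMap ∘ₗ
    (π : A →ₗ[ℂ] (H →L[ℂ] H))

@[simp] lemma vecFun_apply (π : A →⋆ₐ[ℂ] (H →L[ℂ] H)) (h h' : H) (a : A) :
    vecFun π h h' a = ⟪h, π a h'⟫_ℂ := rfl

variable (π : A →⋆ₐ[ℂ] (H →L[ℂ] H)) (σ : B →⋆ₐ[ℂ] (K →L[ℂ] K))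

lemma inner_tensorOp (x : A ⊗[ℂ] B) (h h' : H) (k k' : K) :
    ⟪h ⊗ₜ[ℂ] k, tensorOp π σ x (h' ⊗ₜ k')⟫_ℂ
      = ⟪k, σ (algSliceLeft B (vecFun π h h') x) k'⟫_ℂ := by
  induction x with
  | zero => simp
  | add x y hx hy => simp only [map_add, add_apply, inner_add_right, hx, hy]
  | tmul a b => simp

lemma opNorm_le_of_inner {E : Type*} [NormedAddCommGroup E] [InnerProductSpace ℂ E]
    (T : E →L[ℂ] E) {M : ℝ} (hM : 0 ≤ M) (h : ∀ v w, ‖⟪w, T v⟫_ℂ‖ ≤ M * ‖v‖ * ‖w‖) : ‖T‖ ≤ M := by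
  refine T.opNorm_le_bound hM fun v => ?_
  rcases eq_or_ne (T v) 0 with h0 | h0
  · rw [h0, norm_zero]; positivity
  · have h1 := h v (T v)
    rw [inner_self_eq_norm_sq_to_K, norm_pow, RCLike.norm_ofReal, abs_norm, sq] at h1
    exact le_of_mul_le_mul_right h1 (norm_pos_iff.mpr h0)

/-- The matrix over `B` compressing `x` to the span of the vectors `e`. -/
def compress {n : ℕ} (e : Fin n → H) (x : A ⊗[ℂ] B) : CStarMatrix (Fin n) (Fin n) B :=
  CStarMatrix.ofMatrix fun i j => algSliceLeft B (vecFun π (e i) (e j)) x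

lemma inner_compress {n : ℕ} (e : Fin n → H) (x : A ⊗[ℂ] B) (k l : PiLp 2 (fun _ : Fin n => K)) :
    ⟪∑ i, e i ⊗ₜ[ℂ] l i, tensorOp π σ x (∑ j, e j ⊗ₜ[ℂ] k j)⟫_ℂ
      = ⟪l, matrixRep σ n (compress π e x) k⟫_ℂ := by
  simp only [map_sum, sum_inner, inner_sum, inner_tensorOp, PiLp.inner_apply, matrixRep_apply,
    compress]
  exact Finset.sum_comm

lemma norm_sum_tmul {n : ℕ} {e : Fin n → H} (he : Orthonormal ℂ e)
    (k : PiLp 2 (fun _ : Fin n => K)) : ‖∑ i, e i ⊗ₜ[ℂ] k i‖ = ‖k‖ := by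
  classical
  have h : ⟪∑ i, e i ⊗ₜ[ℂ] k i, ∑ i, e i ⊗ₜ[ℂ] k i⟫_ℂ = ⟪k, k⟫_ℂ := by
    simp only [sum_inner, inner_sum, PiLp.inner_apply, TensorProduct.inner_tmul,
      orthonormal_iff_ite.mp he]
    simp
  have h1 := inner_self_eq_norm_sq_to_K (𝕜 := ℂ) (∑ i, e i ⊗ₜ[ℂ] k i)
  have h2 := inner_self_eq_norm_sq_to_K (𝕜 := ℂ) k
  have h' : ‖∑ i, e i ⊗ₜ[ℂ] k i‖ ^ 2 = ‖k‖ ^ 2 := by exact_mod_cast h1.symm.trans (h.trans h2)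
  exact (pow_left_inj₀ (norm_nonneg _) (norm_nonneg _) two_ne_zero).mp h'

lemma exists_orthonormal_expansion (ξ η : H ⊗[ℂ] K) :
    ∃ (n : ℕ) (e : Fin n → H) (k l : PiLp 2 (fun _ : Fin n => K)), Orthonormal ℂ e ∧
      ξ = ∑ i, e i ⊗ₜ[ℂ] k i ∧ η = ∑ i, e i ⊗ₜ[ℂ] l i := by
  obtain ⟨H', hH', hs⟩ := TensorProduct.exists_finite_submodule_left_of_setFinite {ξ, η}
    (Set.toFinite _)
  let e := stdOrthonormalBasis ℂ H'
  have key : ∀ ζ : H' ⊗[ℂ] K, ∃ k : PiLp 2 (fun _ : Fin (Module.finrank ℂ H') => K),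
      H'.subtype.rTensor K ζ = ∑ i, (e i : H) ⊗ₜ[ℂ] k i := by
    intro ζ
    induction ζ with
    | zero => exact ⟨0, by simp⟩
    | add x y hx hy =>
      obtain ⟨k, hk⟩ := hx
      obtain ⟨l, hl⟩ := hy
      exact ⟨k + l, by simp [hk, hl, TensorProduct.tmul_add, Finset.sum_add_distrib]⟩
    | tmul h k =>
      refine ⟨WithLp.toLp 2 fun i => e.repr h i • k, ?_⟩
      have h1 : (h : H) = ∑ i, e.repr h i • (e i : H) := by
        conv_lhs => rw [← e.sum_repr h]
        simp
      rw [LinearMap.rTensor_tmul, Submodule.subtype_apply]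
      conv_lhs => rw [h1]
      simp [TensorProduct.sum_tmul, TensorProduct.smul_tmul]
  obtain ⟨ξ', hξ⟩ := hs (Set.mem_insert ξ _)
  obtain ⟨η', hη⟩ := hs (Set.mem_insert_of_mem ξ rfl)
  obtain ⟨k, hk⟩ := key ξ'
  obtain ⟨l, hl⟩ := key η'
  exact ⟨_, fun i => e i, k, l, e.orthonormal.comp_linearIsometry H'.subtypeₗᵢ,
    hξ.symm.trans hk, hη.symm.trans hl⟩

/-- The norm of `(π ⊗ σ) x` is largest when `σ` is faithful. -/
lemma norm_tensorOp_le_right {K₀ : Type*} [NormedAddCommGroup K₀] [InnerProductSpace ℂ K₀]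
    [CompleteSpace K₀] {σ₀ : B →⋆ₐ[ℂ] (K₀ →L[ℂ] K₀)} (hσ₀ : Function.Injective σ₀)
    (x : A ⊗[ℂ] B) : ‖tensorOp π σ x‖ ≤ ‖tensorOp π σ₀ x‖ := by
  refine opNorm_le_of_inner _ (ContinuousLinearMap.opNorm_nonneg _) fun ξ η => ?_
  obtain ⟨n, e, k, l, he, rfl, rfl⟩ := exists_orthonormal_expansion ξ η
  rw [inner_compress, norm_sum_tmul he, norm_sum_tmul he]
  let := CStarAlgebra.spectralOrder B
  have := CStarAlgebra.spectralOrderedRing B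
  have h1 : ‖matrixRep σ n (compress π e x)‖ ≤ ‖tensorOp π σ₀ x‖ := by
    refine (NonUnitalStarAlgHom.norm_apply_le _ _).trans ?_
    rw [← NonUnitalStarAlgHom.norm_map (matrixRep σ₀ n) (matrixRep_injective hσ₀ n)]
    refine opNorm_le_of_inner _ (ContinuousLinearMap.opNorm_nonneg _) fun v w => ?_
    rw [← inner_compress, ← norm_sum_tmul he v, ← norm_sum_tmul he w]
    refine (norm_inner_le_norm (𝕜 := ℂ) (∑ i, e i ⊗ₜ[ℂ] w i) _).trans ?_
    rw [mul_comm]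
    exact mul_le_mul_of_nonneg_right (ContinuousLinearMap.le_opNorm _ _) (norm_nonneg _)
  refine (norm_inner_le_norm _ _).trans ?_
  rw [mul_comm]
  exact mul_le_mul_of_nonneg_right (ContinuousLinearMap.le_of_opNorm_le _ h1 _) (norm_nonneg _)

lemma tensorOp_comm (x : A ⊗[ℂ] B) (ξ : H ⊗[ℂ] K) :
    tensorOp σ π (TensorProduct.comm ℂ A B x) (TensorProduct.comm ℂ H K ξ)
      = TensorProduct.comm ℂ H K (tensorOp π σ x ξ) := by
  induction x with
  | zero => simp
  | add x y hx hy => simp only [map_add, add_apply, hx, hy]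
  | tmul a b =>
    induction ξ with
    | zero => simp
    | add x y hx hy => simp only [map_add, hx, hy]
    | tmul h k => simp

lemma norm_tensorOp_comm (x : A ⊗[ℂ] B) :
    ‖tensorOp σ π (TensorProduct.comm ℂ A B x)‖ = ‖tensorOp π σ x‖ := by
  refine le_antisymm
    (ContinuousLinearMap.opNorm_le_bound _ (ContinuousLinearMap.opNorm_nonneg _) fun ξ => ?_)
    (ContinuousLinearMap.opNorm_le_bound _ (ContinuousLinearMap.opNorm_nonneg _) fun ξ => ?_)
  · obtain ⟨ξ, rfl⟩ := (TensorProduct.comm ℂ H K).surjective ξ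
    rw [tensorOp_comm, TensorProduct.norm_comm, TensorProduct.norm_comm]
    exact ContinuousLinearMap.le_opNorm _ _
  · have := (tensorOp σ π (TensorProduct.comm ℂ A B x)).le_opNorm (TensorProduct.comm ℂ H K ξ)
    rwa [tensorOp_comm, TensorProduct.norm_comm, TensorProduct.norm_comm] at this

/-- The norm of `(π ⊗ σ) x` is largest when both `π` and `σ` are faithful. -/
lemma norm_tensorOp_le {H₀ : Type*} [NormedAddCommGroup H₀] [InnerProductSpace ℂ H₀]
    [CompleteSpace H₀] {π₀ : A →⋆ₐ[ℂ] (H₀ →L[ℂ] H₀)} (hπ₀ : Function.Injective π₀)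
    {K₀ : Type*} [NormedAddCommGroup K₀] [InnerProductSpace ℂ K₀]
    [CompleteSpace K₀] {σ₀ : B →⋆ₐ[ℂ] (K₀ →L[ℂ] K₀)} (hσ₀ : Function.Injective σ₀)
    (x : A ⊗[ℂ] B) : ‖tensorOp π σ x‖ ≤ ‖tensorOp π₀ σ₀ x‖ := by
  refine (norm_tensorOp_le_right π σ hσ₀ x).trans ?_
  rw [← norm_tensorOp_comm π σ₀, ← norm_tensorOp_comm π₀ σ₀]
  exact norm_tensorOp_le_right σ₀ π hπ₀ _

end Slice
section ClosedRange
variable {R : Type*} [Semiring R] [StarRing R] [Algebra ℂ R] {D : Type*} [CStarAlgebra D]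

/-- The norm closure of the range of a `*`-homomorphism into a C⋆-algebra. -/
def closedRange (ρ : R →⋆ₐ[ℂ] D) : StarSubalgebra ℂ D := ρ.range.topologicalClosure

instance (ρ : R →⋆ₐ[ℂ] D) : CStarAlgebra (closedRange ρ) :=
  StarSubalgebra.cstarAlgebra (closedRange ρ)
    (h_closed := StarSubalgebra.isClosed_topologicalClosure _)

/-- A `*`-homomorphism as a map into the closure of its range. -/
def toClosedRange (ρ : R →⋆ₐ[ℂ] D) : R →⋆ₐ[ℂ] closedRange ρ :=
  ρ.codRestrict (closedRange ρ) fun x => StarSubalgebra.le_topologicalClosure _ ⟨x, rfl⟩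

/-- The inclusion of the closure of the range. -/
def closedRangeSubtype (ρ : R →⋆ₐ[ℂ] D) : closedRange ρ →⋆ₐ[ℂ] D := (closedRange ρ).subtype

lemma norm_toClosedRange (ρ : R →⋆ₐ[ℂ] D) (x : R) : ‖toClosedRange ρ x‖ = ‖ρ x‖ := rfl

lemma denseRange_toClosedRange (ρ : R →⋆ₐ[ℂ] D) : DenseRange (toClosedRange ρ) := by
  intro t
  rw [Topology.IsEmbedding.subtypeVal.closure_eq_preimage_closure_image, ← Set.range_comp]
  exact t.2

end ClosedRange
section TensorOps
variable (H : Type*) [NormedAddCommGroup H] [InnerProductSpace ℂ H]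
  (K : Type*) [NormedAddCommGroup K] [InnerProductSpace ℂ K]

/-- The bounded operators on the Hilbert space tensor product of `H` and `K`. -/
def TensorOps : Type _ := Completion (H ⊗[ℂ] K) →L[ℂ] Completion (H ⊗[ℂ] K)

instance : CStarAlgebra (TensorOps H K) :=
  inferInstanceAs (CStarAlgebra (Completion (H ⊗[ℂ] K) →L[ℂ] Completion (H ⊗[ℂ] K)))

/-- The identity map. -/
def TensorOps.toCLM :
    TensorOps H K →⋆ₐ[ℂ] (Completion (H ⊗[ℂ] K) →L[ℂ] Completion (H ⊗[ℂ] K)) where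
  toFun T := T
  map_one' := rfl
  map_mul' _ _ := rfl
  map_zero' := rfl
  map_add' _ _ := rfl
  commutes' _ := rfl
  map_star' _ := rfl

variable {H K} {A : Type*} {B : Type*} [CStarAlgebra A] [CStarAlgebra B]
  [CompleteSpace H] [CompleteSpace K]

/-- The representation `π ⊗ σ`. -/
def tensorHom (π : A →⋆ₐ[ℂ] (H →L[ℂ] H)) (σ : B →⋆ₐ[ℂ] (K →L[ℂ] K)) :
    A ⊗[ℂ] B →⋆ₐ[ℂ] TensorOps H K where
  toFun x := tensorRep π σ x
  map_one' := map_one (tensorRep π σ)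
  map_mul' := map_mul (tensorRep π σ)
  map_zero' := map_zero (tensorRep π σ)
  map_add' := map_add (tensorRep π σ)
  commutes' := AlgHomClass.commutes (tensorRep π σ)
  map_star' := map_star (tensorRep π σ)

lemma norm_tensorHom (π : A →⋆ₐ[ℂ] (H →L[ℂ] H)) (σ : B →⋆ₐ[ℂ] (K →L[ℂ] K)) (x : A ⊗[ℂ] B) :
    ‖tensorHom π σ x‖ = ‖tensorOp π σ x‖ := norm_tensorRep π σ x

end TensorOps

section Defn
variable (A : Type u) (B : Type v) [CStarAlgebra A] [CStarAlgebra B]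

/-- The minimal (spatial) tensor product of two unital C⋆-algebras: the norm closure of the image of
the algebraic tensor product under the tensor product of the universal representations. -/
def _root_.MinTensor : Type (max u v) := closedRange (tensorHom (univRep A) (univRep B))

instance : CStarAlgebra (MinTensor A B) :=
  inferInstanceAs (CStarAlgebra (closedRange (tensorHom (univRep A) (univRep B))))

/-- The defining faithful representation of the minimal tensor product. -/
def incl : MinTensor A B →⋆ₐ[ℂ]
    (Completion (UnivSpace A ⊗[ℂ] UnivSpace B) →L[ℂ] Completion (UnivSpace A ⊗[ℂ] UnivSpace B)) :=
  (TensorOps.toCLM (UnivSpace A) (UnivSpace B)).comp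
    (closedRangeSubtype (tensorHom (univRep A) (univRep B)))

lemma incl_injective : Function.Injective (incl A B) := Subtype.val_injective

/-- The canonical map from the algebraic to the minimal tensor product. -/
def of : A ⊗[ℂ] B →⋆ₐ[ℂ] MinTensor A B := toClosedRange (tensorHom (univRep A) (univRep B))

variable {A B}

lemma incl_of (x : A ⊗[ℂ] B) : incl A B (of A B x) = tensorRep (univRep A) (univRep B) x := rfl

lemma norm_of (x : A ⊗[ℂ] B) : ‖of A B x‖ = ‖tensorOp (univRep A) (univRep B) x‖ :=
  (norm_toClosedRange _ x).trans (norm_tensorHom _ _ x)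

lemma denseRange_of : DenseRange (of A B) :=
  denseRange_toClosedRange (tensorHom (univRep A) (univRep B))

/-- The elementary tensor `a ⊗ b` in the minimal tensor product. -/
def tmul (a : A) (b : B) : MinTensor A B := of A B (a ⊗ₜ b)

lemma norm_tensorOp_le_norm_of {H : Type*} [NormedAddCommGroup H] [InnerProductSpace ℂ H]
    [CompleteSpace H] {K : Type*} [NormedAddCommGroup K] [InnerProductSpace ℂ K] [CompleteSpace K]
    (π : A →⋆ₐ[ℂ] (H →L[ℂ] H)) (σ : B →⋆ₐ[ℂ] (K →L[ℂ] K)) (x : A ⊗[ℂ] B) :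
    ‖tensorOp π σ x‖ ≤ ‖of A B x‖ :=
  (norm_tensorOp_le π σ univRep_injective univRep_injective x).trans_eq (norm_of x).symm

end Defn

section Slice
variable {A : Type u} {B : Type v} [CStarAlgebra A] [CStarAlgebra B]

/-- The slice map `a ⊗ b ↦ ν b • a` on the algebraic tensor product. -/
def algSliceRight (A : Type*) [CStarAlgebra A] (ν : B →ₗ[ℂ] ℂ) : A ⊗[ℂ] B →ₗ[ℂ] A :=
  (TensorProduct.rid ℂ A).toLinearMap ∘ₗ ν.lTensor A

@[simp] lemma algSliceRight_tmul (ν : B →ₗ[ℂ] ℂ) (a : A) (b : B) :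
    algSliceRight A ν (a ⊗ₜ b) = ν b • a := by
  simp [algSliceRight]

lemma norm_algSliceLeft_le (μ : A →L[ℂ] ℂ) (x : A ⊗[ℂ] B) :
    ‖algSliceLeft B (μ : A →ₗ[ℂ] ℂ) x‖ ≤ ‖μ‖ * ‖of A B x‖ := by
  rw [← NonUnitalStarAlgHom.norm_map (univRep B) univRep_injective]
  refine opNorm_le_of_inner _ (by positivity) fun k l => ?_
  have h1 : ⟪l, univRep B (algSliceLeft B (μ : A →ₗ[ℂ] ℂ) x) k⟫_ℂ
      = μ (algSliceRight A (vecFun (univRep B) l k) x) := by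
    induction x with
    | zero => simp
    | add x y hx hy => simp only [map_add, add_apply, inner_add_right, hx, hy]
    | tmul a b => simp [mul_comm]
  rw [h1]
  clear h1
  have h2 : ‖algSliceRight A (vecFun (univRep B) l k) x‖ ≤ ‖of A B x‖ * (‖k‖ * ‖l‖) := by
    rw [← NonUnitalStarAlgHom.norm_map (univRep A) univRep_injective]
    refine opNorm_le_of_inner _ (by positivity) fun h h' => ?_
    have h3 : ⟪h', univRep A (algSliceRight A (vecFun (univRep B) l k) x) h⟫_ℂ
        = ⟪h' ⊗ₜ[ℂ] l, tensorOp (univRep A) (univRep B) x (h ⊗ₜ k)⟫_ℂ := by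
      induction x with
      | zero => simp
      | add x y hx hy => simp only [map_add, add_apply, inner_add_right, hx, hy]
      | tmul a b => simp [mul_comm]
    rw [h3]
    refine (norm_inner_le_norm (𝕜 := ℂ) (h' ⊗ₜ[ℂ] l) _).trans ?_
    have h4 := (tensorOp (univRep A) (univRep B) x).le_opNorm (h ⊗ₜ k)
    rw [← norm_of, TensorProduct.norm_tmul] at h4
    rw [TensorProduct.norm_tmul]
    calc _ ≤ ‖h'‖ * ‖l‖ * (‖of A B x‖ * (‖h‖ * ‖k‖)) := by gcongr
      _ = _ := by ring
  calc _ ≤ ‖μ‖ * (‖of A B x‖ * (‖k‖ * ‖l‖)) := μ.le_opNorm_of_le h2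
    _ = _ := by ring

variable (B) in
/-- The slice map `μ ⊗ id`, the bounded linear extension of `a ⊗ b ↦ μ a • b`. -/
def sliceLeft (μ : A →L[ℂ] ℂ) : MinTensor A B →L[ℂ] B :=
  (algSliceLeft B (μ : A →ₗ[ℂ] ℂ)).extendOfNorm (of A B : A ⊗[ℂ] B →ₗ[ℂ] MinTensor A B)

lemma sliceLeft_of (μ : A →L[ℂ] ℂ) (x : A ⊗[ℂ] B) :
    sliceLeft B μ (of A B x) = algSliceLeft B (μ : A →ₗ[ℂ] ℂ) x :=
  LinearMap.extendOfNorm_eq (e := (of A B : A ⊗[ℂ] B →ₗ[ℂ] MinTensor A B)) denseRange_of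
    ⟨‖μ‖, norm_algSliceLeft_le μ⟩ x

@[simp] lemma sliceLeft_tmul (μ : A →L[ℂ] ℂ) (a : A) (b : B) :
    sliceLeft B μ (tmul a b) = μ a • b := by
  simp [tmul, sliceLeft_of]

end Slice

section Map
variable {A A' : Type*} {B B' : Type*} [CStarAlgebra A] [CStarAlgebra B]
  [CStarAlgebra A'] [CStarAlgebra B']

/-- The map `a ⊗ b ↦ f a ⊗ g b` from the algebraic to the minimal tensor product. -/
def algMap (f : A →⋆ₐ[ℂ] A') (g : B →⋆ₐ[ℂ] B') : A ⊗[ℂ] B →ₗ[ℂ] MinTensor A' B' :=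
  (of A' B' : A' ⊗[ℂ] B' →ₗ[ℂ] MinTensor A' B') ∘ₗ
    TensorProduct.map (f : A →ₗ[ℂ] A') (g : B →ₗ[ℂ] B')

lemma norm_algMap_le (f : A →⋆ₐ[ℂ] A') (g : B →⋆ₐ[ℂ] B') (x : A ⊗[ℂ] B) :
    ‖algMap f g x‖ ≤ ‖of A B x‖ := by
  have h : tensorOp (univRep A') (univRep B')
      (TensorProduct.map (f : A →ₗ[ℂ] A') (g : B →ₗ[ℂ] B') x)
      = tensorOp ((univRep A').comp f) ((univRep B').comp g) x := by
    induction x with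
    | zero => simp
    | add x y hx hy => simp only [map_add, hx, hy]
    | tmul a b => rfl
  refine (norm_of _).trans_le ?_
  rw [h]
  exact norm_tensorOp_le_norm_of _ _ x

/-- The map `f ⊗ g`, the bounded linear extension of `a ⊗ b ↦ f a ⊗ g b`. -/
def map (f : A →⋆ₐ[ℂ] A') (g : B →⋆ₐ[ℂ] B') : MinTensor A B →L[ℂ] MinTensor A' B' :=
  (algMap f g).extendOfNorm (of A B : A ⊗[ℂ] B →ₗ[ℂ] MinTensor A B)

@[simp] lemma map_tmul (f : A →⋆ₐ[ℂ] A') (g : B →⋆ₐ[ℂ] B') (a : A) (b : B) :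
    map f g (tmul a b) = tmul (f a) (g b) :=
  LinearMap.extendOfNorm_eq (f := algMap f g) (e := (of A B : A ⊗[ℂ] B →ₗ[ℂ] MinTensor A B))
    denseRange_of ⟨1, fun x => by rw [one_mul]; exact norm_algMap_le f g x⟩ (a ⊗ₜ b)

end Map

section Assoc
variable (A : Type*) (B : Type*) (C : Type*) [CStarAlgebra A] [CStarAlgebra B] [CStarAlgebra C]

/-- The canonical map `(A ⊙ B) ⊙ C → (A ⊗ B) ⊗ C`. -/
def ofLeft : (A ⊗[ℂ] B) ⊗[ℂ] C →ₗ[ℂ] MinTensor (MinTensor A B) C :=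
  (of (MinTensor A B) C : MinTensor A B ⊗[ℂ] C →ₗ[ℂ] MinTensor (MinTensor A B) C) ∘ₗ
    (of A B : A ⊗[ℂ] B →ₗ[ℂ] MinTensor A B).rTensor C

/-- The canonical map `A ⊙ (B ⊙ C) → A ⊗ (B ⊗ C)`. -/
def ofRight : A ⊗[ℂ] (B ⊗[ℂ] C) →ₗ[ℂ] MinTensor A (MinTensor B C) :=
  (of A (MinTensor B C) : A ⊗[ℂ] MinTensor B C →ₗ[ℂ] MinTensor A (MinTensor B C)) ∘ₗ
    (of B C : B ⊗[ℂ] C →ₗ[ℂ] MinTensor B C).lTensor A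

variable {A B C}

lemma norm_tmul_le (a : A) (b : B) : ‖tmul a b‖ ≤ ‖a‖ * ‖b‖ := by
  refine (norm_of _).trans_le ?_
  refine (TensorProduct.norm_mapL_le _ _).trans ?_
  gcongr <;> exact NonUnitalStarAlgHom.norm_apply_le _ _

lemma continuous_tmul_left (c : B) : Continuous fun a : A => (tmul a c : MinTensor A B) :=
  ((LinearMap.mkContinuous
    { toFun := fun a : A => (tmul a c : MinTensor A B)
      map_add' := fun a a' => by simp [tmul, TensorProduct.add_tmul]
      map_smul' := fun r a => by
        simp only [tmul, RingHom.id_apply]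
        rw [← TensorProduct.smul_tmul', map_smul] } ‖c‖ fun a => by
        rw [mul_comm]; exact norm_tmul_le a c) : A →L[ℂ] MinTensor A B).continuous

lemma denseRange_ofLeft : DenseRange (ofLeft A B C) := by
  have h1 : ∀ (t : MinTensor A B) (c : C),
      tmul t c ∈ (LinearMap.range (ofLeft A B C)).topologicalClosure := by
    intro t c
    induction t using denseRange_of.induction_on with
    | hp => exact (Submodule.isClosed_topologicalClosure _).preimage (continuous_tmul_left c)
    | ih x => exact Submodule.le_topologicalClosure _ ⟨x ⊗ₜ c, rfl⟩
  have h2 : ∀ y : MinTensor A B ⊗[ℂ] C,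
      of _ _ y ∈ (LinearMap.range (ofLeft A B C)).topologicalClosure := by
    intro y
    induction y with
    | zero => rw [map_zero]; exact zero_mem _
    | add x y hx hy => rw [map_add]; exact add_mem hx hy
    | tmul t c => exact h1 t c
  intro s
  change s ∈ (LinearMap.range (ofLeft A B C)).topologicalClosure
  induction s using denseRange_of.induction_on with
  | hp => exact Submodule.isClosed_topologicalClosure _
  | ih y => exact h2 y

lemma denseRange_lTensor {H E E' : Type*} [NormedAddCommGroup H] [InnerProductSpace ℂ H]
    [NormedAddCommGroup E] [InnerProductSpace ℂ E] [NormedAddCommGroup E'] [InnerProductSpace ℂ E']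
    (f : E →ₗᵢ[ℂ] E') (hf : DenseRange f) : DenseRange (f.lTensor H) := by
  have h1 : ∀ ξ, ξ ∈ (LinearMap.range (f.lTensor H).toLinearMap).topologicalClosure := by
    intro ξ
    induction ξ with
    | zero => exact zero_mem _
    | add x y hx hy => exact add_mem hx hy
    | tmul h t =>
      induction t using hf.induction_on with
      | hp =>
        exact (Submodule.isClosed_topologicalClosure _).preimage
          (TensorProduct.mkL ℂ H E' h).continuous
      | ih t => exact Submodule.le_topologicalClosure _ ⟨h ⊗ₜ t, rfl⟩
  exact h1

section
variable (H K L : Type*) [NormedAddCommGroup H] [InnerProductSpace ℂ H]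
  [NormedAddCommGroup K] [InnerProductSpace ℂ K] [NormedAddCommGroup L] [InnerProductSpace ℂ L]

/-- The isometric inclusion of `(H ⊗ K) ⊗ L` with the first factor completed. -/
def complLeft : (H ⊗[ℂ] K) ⊗[ℂ] L →ₗᵢ[ℂ] Completion (H ⊗[ℂ] K) ⊗[ℂ] L :=
  (Completion.toComplₗᵢ (𝕜 := ℂ) (E := H ⊗[ℂ] K)).rTensor L

/-- The isometric inclusion of `H ⊗ (K ⊗ L)` with the second factor completed. -/
def complRight : H ⊗[ℂ] (K ⊗[ℂ] L) →ₗᵢ[ℂ] H ⊗[ℂ] Completion (K ⊗[ℂ] L) :=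
  (Completion.toComplₗᵢ (𝕜 := ℂ) (E := K ⊗[ℂ] L)).lTensor H

end

lemma exists_threefold (x : (A ⊗[ℂ] B) ⊗[ℂ] C) :
    ∃ T : (UnivSpace A ⊗[ℂ] UnivSpace B) ⊗[ℂ] UnivSpace C →ₗ[ℂ]
        (UnivSpace A ⊗[ℂ] UnivSpace B) ⊗[ℂ] UnivSpace C, ∀ ζ,
      tensorOp (incl A B) (univRep C)
          ((of A B : A ⊗[ℂ] B →ₗ[ℂ] MinTensor A B).rTensor C x) (complLeft _ _ _ ζ)
        = complLeft _ _ _ (T ζ) ∧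
      tensorOp (univRep A) (incl B C)
          ((of B C : B ⊗[ℂ] C →ₗ[ℂ] MinTensor B C).lTensor A (TensorProduct.assoc ℂ A B C x))
          (complRight _ _ _ (TensorProduct.assoc ℂ _ _ _ ζ))
        = complRight _ _ _ (TensorProduct.assoc ℂ _ _ _ (T ζ)) := by
  induction x with
  | zero => exact ⟨0, fun ζ => by simp [LinearIsometry.map_zero]⟩
  | add x y hx hy =>
    obtain ⟨T, hT⟩ := hx
    obtain ⟨S, hS⟩ := hy
    refine ⟨T + S, fun ζ => ⟨?_, ?_⟩⟩
    · simp only [map_add, add_apply, LinearMap.add_apply, (hT ζ).1, (hS ζ).1]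
    · simp only [map_add, add_apply, LinearMap.add_apply, (hT ζ).2, (hS ζ).2]
  | tmul y c =>
    induction y with
    | zero => exact ⟨0, fun ζ => by simp [LinearIsometry.map_zero]⟩
    | add x y hx hy =>
      obtain ⟨T, hT⟩ := hx
      obtain ⟨S, hS⟩ := hy
      refine ⟨T + S, fun ζ => ⟨?_, ?_⟩⟩
      · simp only [TensorProduct.add_tmul, map_add, add_apply, LinearMap.add_apply,
          (hT ζ).1, (hS ζ).1]
      · simp only [TensorProduct.add_tmul, map_add, add_apply, LinearMap.add_apply,
          (hT ζ).2, (hS ζ).2]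
    | tmul a b =>
      refine ⟨TensorProduct.map (TensorProduct.map (univRep A a).toLinearMap
        (univRep B b).toLinearMap) (univRep C c).toLinearMap, fun ζ => ?_⟩
      induction ζ with
      | zero => simp [LinearIsometry.map_zero]
      | add x y hx hy => simp only [map_add, hx.1, hy.1, hx.2, hy.2, and_self]
      | tmul w l =>
        induction w with
        | zero => simp [LinearIsometry.map_zero]
        | add x y hx hy =>
          simp only [TensorProduct.add_tmul, map_add, hx.1, hy.1, hx.2, hy.2, and_self]
        | tmul h k =>
          constructor
          · change (incl A B (of A B (a ⊗ₜ b)) ((h ⊗ₜ[ℂ] k : UnivSpace A ⊗[ℂ] UnivSpace B) :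
              Completion (UnivSpace A ⊗[ℂ] UnivSpace B))) ⊗ₜ[ℂ] (univRep C c l) = _
            rw [incl_of, tensorRep_coe]
            rfl
          · change (univRep A a h) ⊗ₜ[ℂ] (incl B C (of B C (b ⊗ₜ c))
              ((k ⊗ₜ[ℂ] l : UnivSpace B ⊗[ℂ] UnivSpace C) :
                Completion (UnivSpace B ⊗[ℂ] UnivSpace C))) = _
            rw [incl_of, tensorRep_coe]
            rfl

lemma norm_ofRight_assoc_le (x : (A ⊗[ℂ] B) ⊗[ℂ] C) :
    ‖ofRight A B C (TensorProduct.assoc ℂ A B C x)‖ ≤ ‖ofLeft A B C x‖ := by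
  refine (norm_of _).trans_le ((norm_tensorOp_le_right (univRep A) (univRep (MinTensor B C))
    (incl_injective B C) _).trans ?_)
  refine le_trans ?_ (norm_tensorOp_le_norm_of (incl A B) (univRep C) _)
  obtain ⟨T, hT⟩ := exists_threefold x
  refine ContinuousLinearMap.opNorm_le_bound _ (ContinuousLinearMap.opNorm_nonneg _) fun ξ => ?_
  have hd : DenseRange (complRight (UnivSpace A) (UnivSpace B) (UnivSpace C)) :=
    denseRange_lTensor _ Completion.denseRange_coe
  induction ξ using hd.induction_on with
  | hp => apply isClosed_le <;> fun_prop
  | ih ζ =>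
    obtain ⟨ζ, rfl⟩ := (TensorProduct.assoc ℂ (UnivSpace A) (UnivSpace B) (UnivSpace C)).surjective ζ
    rw [(hT ζ).2, LinearIsometry.norm_map, LinearIsometry.norm_map, TensorProduct.norm_assoc,
      TensorProduct.norm_assoc, ← (complLeft _ _ _).norm_map (T ζ), ← (hT ζ).1,
      ← (complLeft _ _ _).norm_map ζ]
    exact (tensorOp (incl A B) (univRep C) _).le_opNorm _

variable (A B C) in
/-- The associativity map, the bounded linear extension of `(a ⊗ b) ⊗ c ↦ a ⊗ (b ⊗ c)`. -/
def assoc : MinTensor (MinTensor A B) C →L[ℂ] MinTensor A (MinTensor B C) :=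
  (ofRight A B C ∘ₗ (TensorProduct.assoc ℂ A B C).toLinearMap).extendOfNorm (ofLeft A B C)

@[simp] lemma assoc_tmul (a : A) (b : B) (c : C) :
    assoc A B C (tmul (tmul a b) c) = tmul a (tmul b c) :=
  LinearMap.extendOfNorm_eq
    (f := ofRight A B C ∘ₗ (TensorProduct.assoc ℂ A B C).toLinearMap) (e := ofLeft A B C)
    denseRange_ofLeft ⟨1, fun x => by rw [one_mul]; exact norm_ofRight_assoc_le x⟩
    ((a ⊗ₜ b) ⊗ₜ c)

end Assoc

section Linear
variable {A : Type*} {B : Type*} [CStarAlgebra A] [CStarAlgebra B]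

variable (A B) in
/-- The `*`-homomorphism `a ↦ a ⊗ 1`. -/
def inl : A →⋆ₐ[ℂ] MinTensor A B where
  toFun a := tmul a 1
  map_one' := map_one (of A B)
  map_mul' a a' := by simp [tmul, ← map_mul]
  map_zero' := by simp [tmul]
  map_add' a a' := by simp [tmul, TensorProduct.add_tmul]
  commutes' c := AlgHomClass.commutes (of A B) c
  map_star' a := by simp [tmul, ← map_star]

lemma sliceLeft_add (μ ν : A →L[ℂ] ℂ) (t : MinTensor A B) :
    sliceLeft B (μ + ν) t = sliceLeft B μ t + sliceLeft B ν t := by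
  induction t using denseRange_of.induction_on with
  | hp => apply isClosed_eq <;> fun_prop
  | ih x =>
    simp only [sliceLeft_of]
    induction x with
    | zero => simp
    | add x y hx hy => simp only [map_add, hx, hy]; abel
    | tmul a b => simp [add_smul]

lemma sliceLeft_smul (c : ℂ) (μ : A →L[ℂ] ℂ) (t : MinTensor A B) :
    sliceLeft B (c • μ) t = c • sliceLeft B μ t := by
  induction t using denseRange_of.induction_on with
  | hp => apply isClosed_eq <;> fun_prop
  | ih x =>
    simp only [sliceLeft_of]
    induction x with
    | zero => simp
    | add x y hx hy => simp only [map_add, hx, hy, smul_add]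
    | tmul a b => simp [mul_smul]

end Linear

end MinTensor

open MinTensor

/-- A compact quantum group structure on the unital C⋆-algebra `A`. -/
structure CompactQuantumGroup (A : Type u) [CStarAlgebra A] where
  /-- the comultiplication -/
  comul : A →⋆ₐ[ℂ] MinTensor A A
  /-- `(Δ ⊗ id) Δ = (id ⊗ Δ) Δ` -/
  coassoc : ∀ a, assoc A A A (MinTensor.map comul (StarAlgHom.id ℂ A) (comul a))
    = MinTensor.map (StarAlgHom.id ℂ A) comul (comul a)
  /-- the linear span of `Δ(A)(1 ⊗ A)` is dense -/
  dense_right : Dense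
    (Submodule.span ℂ {x | ∃ a b : A, x = comul a * tmul 1 b} : Set (MinTensor A A))
  /-- the linear span of `Δ(A)(A ⊗ 1)` is dense -/
  dense_left : Dense
    (Submodule.span ℂ {x | ∃ a b : A, x = comul a * tmul b 1} : Set (MinTensor A A))

namespace CompactQuantumGroup

/-- An action of a compact quantum group on a unital C⋆-algebra `B`. -/
structure Action {A : Type u} [CStarAlgebra A] (G : CompactQuantumGroup A)
    (B : Type v) [CStarAlgebra B] where
  /-- the coaction map `α : B → B ⊗ A` -/
  coact : B →⋆ₐ[ℂ] MinTensor B A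
  /-- `(α ⊗ id) α = (id ⊗ Δ) α` -/
  coassoc : ∀ b, assoc B A A (MinTensor.map coact (StarAlgHom.id ℂ A) (coact b))
    = MinTensor.map (StarAlgHom.id ℂ B) G.comul (coact b)
  /-- the linear span of `α(B)(1 ⊗ A)` is dense -/
  dense : Dense
    (Submodule.span ℂ {x | ∃ (b : B) (a : A), x = coact b * tmul 1 a} : Set (MinTensor B A))

namespace Action
variable {A : Type u} [CStarAlgebra A] {G : CompactQuantumGroup A}
  {B : Type v} [CStarAlgebra B] (α : G.Action B)

/-- The fixed-point algebra `{b | α b = b ⊗ 1}`. -/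
def fixedPoints : StarSubalgebra ℂ B := StarAlgHom.equalizer α.coact (inl B A)

/-- The action is ergodic if the fixed-point algebra consists of the scalars only. -/
def IsErgodic : Prop := (α.fixedPoints : Set B) = {b | ∃ c : ℂ, b = c • (1 : B)}

/-- A bounded functional `μ` is invariant if `(μ ⊗ id) (α b) = μ b • 1` for all `b`. -/
def IsInvariant (μ : StrongDual ℂ B) : Prop := ∀ b, sliceLeft A μ (α.coact b) = μ b • (1 : A)

/-- The space of invariant bounded functionals, with the norm of the dual of `B`. -/
def invariantFunctionals : Submodule ℂ (StrongDual ℂ B) where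
  carrier := {μ | α.IsInvariant μ}
  add_mem' {μ ν} hμ hν b := by rw [sliceLeft_add, hμ b, hν b, add_apply, add_smul]
  zero_mem' b := by
    rw [← zero_smul ℂ (0 : StrongDual ℂ B), sliceLeft_smul]
    simp
  smul_mem' c μ hμ b := by rw [sliceLeft_smul, hμ b, smul_apply, smul_smul, smul_eq_mul]

/-- The restriction of invariant bounded functionals to the fixed-point algebra. -/
def restrict : α.invariantFunctionals →ₗ[ℂ] StrongDual ℂ α.fixedPoints where
  toFun ψ := (ψ : StrongDual ℂ B).comp
    (⟨α.fixedPoints.subtype, continuous_subtype_val⟩ : α.fixedPoints →L[ℂ] B)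
  map_add' _ _ := rfl
  map_smul' _ _ := rfl

lemma restrict_apply (ψ : α.invariantFunctionals) (b : α.fixedPoints) :
    α.restrict ψ b = (ψ : StrongDual ℂ B) (b : B) := rfl

end Action

end CompactQuantumGroup

/-- A state: a bounded functional that is positive and takes the value `1` at the unit. -/
def IsState {B : Type v} [CStarAlgebra B] (μ : StrongDual ℂ B) : Prop :=
  (∀ b, 0 ≤ μ (star b * b)) ∧ μ 1 = 1

end

/-!
Everything follows from one contractive projection `E` of `B` onto the fixed-point algebra `B^α`
such that the invariant functionals are exactly the functionals that factor through `E`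
(`CompactQuantumGroup.Action.exists_conditionalExpectation`). Restriction to `B^α` is then inverted
by composition with `E`, isometrically because `‖E‖ ≤ 1`. The invariant states are the states
`g ∘ E`, so they all coincide if `B^α` is trivial; conversely, if there is only one, all states of
`B` agree on `B^α`, and since states separate points `B^α` consists of scalars.

The projection is `E = (id ⊗ h) ∘ α`, where `h` is the Haar state of the quantum group, a state
with `ν * h = ν(1) h = h * ν` for all functionals `ν`, with `μ * ν = (μ ⊗ ν) ∘ Δ`. Both
invariance properties are used: the left one makes `E b` a fixed point, the right one makes
`μ ∘ E` invariant. The Haar state is obtained without separability, following Van Daele: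

* For a state `ω`, a weak-* cluster point `h` of the Cesàro means of the convolution powers of `ω`
  satisfies `ω * h = h = h * ω` (`exists_conv_eq_self`).
* If `ω` is an average of states `ρ i`, then such an `h` satisfies `ρ i * h = h = h * ρ i` for every
  `i` (`absorb_of_absorb_average`). This is where positivity and the density conditions of a
  compact quantum group enter.
* Hence the weak-* closed conditions `ρ * h = h = h * ρ`, for all states `ρ`, have the finite
  intersection property on the compact state space, and a common solution exists (`exists_haar`).

States are handled as unital functionals of norm at most one. This makes positivity of product
functionals immediate, since `‖μ ⊗ ν‖ ≤ ‖μ‖ ‖ν‖`. Identities in a minimal tensor product are checked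
by applying product functionals, which separate its points (`MinTensor.eq_of_forall_prodFun`).
-/

noncomputable section

open scoped ComplexOrder TensorProduct InnerProductSpace ENNReal
open UniformSpace Filter Topology

universe u v

/-! ### States as unital contractive functionals -/

section States
variable {A : Type*} [CStarAlgebra A]

/-- A unital functional of norm at most one. These are exactly the states (`IsState`); this form is
the convenient one because contractivity and unitality pass to product functionals at once. -/
def IsUnitalContraction (g : StrongDual ℂ A) : Prop := ‖g‖ ≤ 1 ∧ g 1 = 1

namespace IsUnitalContraction
variable {g : StrongDual ℂ A}

lemma exists_positiveLinearMap (hg : IsUnitalContraction g) :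
    letI := CStarAlgebra.spectralOrder A
    letI := CStarAlgebra.spectralOrderedRing A
    ∃ f : A →ₚ[ℂ] ℂ, ∀ a, f a = g a :=
  letI := CStarAlgebra.spectralOrder A
  letI := CStarAlgebra.spectralOrderedRing A
  ⟨PositiveLinearMap.mk₀ (g : A →ₗ[ℂ] ℂ) fun _ hx =>
    MinTensor.nonneg_of_norm_le_one g hg.1 hg.2 hx, fun _ => rfl⟩

lemma isState (hg : IsUnitalContraction g) : IsState g :=
  letI := CStarAlgebra.spectralOrder A
  letI := CStarAlgebra.spectralOrderedRing A
  ⟨fun b => MinTensor.nonneg_of_norm_le_one g hg.1 hg.2 (star_mul_self_nonneg b), hg.2⟩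

lemma map_star (hg : IsUnitalContraction g) (a : A) : g (star a) = star (g a) := by
  let := CStarAlgebra.spectralOrder A
  have := CStarAlgebra.spectralOrderedRing A
  obtain ⟨f, hf⟩ := hg.exists_positiveLinearMap
  rw [← hf, ← hf, StarHomClass.map_star]

/-- By the Cauchy–Schwarz inequality, a state annihilating `y* y` annihilates the left ideal
generated by `y`. -/
lemma map_mul_eq_zero (hg : IsUnitalContraction g) {y : A} (hy : g (star y * y) = 0) (c : A) :
    g (c * y) = 0 := by
  let := CStarAlgebra.spectralOrder A
  have := CStarAlgebra.spectralOrderedRing A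
  obtain ⟨f, hf⟩ := hg.exists_positiveLinearMap
  have h1 : ⟪f.toPreGNS (star c), f.toPreGNS y⟫_ℂ = g (c * y) := by
    rw [f.preGNS_inner_def, ← hf]; simp
  have h2 : ‖f.toPreGNS y‖ = 0 := by
    have := f.preGNS_norm_sq (f.toPreGNS y)
    simp only [PositiveLinearMap.ofPreGNS_toPreGNS, hf, hy] at this
    simpa using this
  have h3 := norm_inner_le_norm (𝕜 := ℂ) (f.toPreGNS (star c)) (f.toPreGNS y)
  rw [h1, h2, mul_zero] at h3
  exact norm_le_zero_iff.mp h3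

end IsUnitalContraction

/-- A nonzero self-adjoint element has a nonzero spectral value, hence a character of the commutative
C⋆-algebra it generates is nonzero on it; a Hahn–Banach extension of this character is a state. -/
lemma exists_isUnitalContraction_apply_ne_zero {b : A} (hbsa : IsSelfAdjoint b) (hb : b ≠ 0) :
    ∃ g : StrongDual ℂ A, IsUnitalContraction g ∧ g b ≠ 0 := by
  have : Nontrivial A := ⟨b, 0, hb⟩
  have : IsStarNormal b := hbsa.isStarNormal
  let S := StarAlgebra.elemental ℂ b
  let b' : S := ⟨b, StarAlgebra.elemental.self_mem ℂ b⟩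
  have hspec : ∃ z ∈ spectrum ℂ b', z ≠ 0 := by
    by_contra hcon
    push Not at hcon
    have hb'sa : IsSelfAdjoint b' := Subtype.ext hbsa
    have h0 : spectralRadius ℂ b' = 0 := by
      rw [spectralRadius]
      simp only [ENNReal.iSup_eq_zero]
      intro z hz
      simp [hcon z hz]
    rw [hb'sa.spectralRadius_eq_nnnorm] at h0
    exact hb (congrArg Subtype.val (nnnorm_eq_zero.mp (by exact_mod_cast h0) : b' = 0))
  obtain ⟨z, hz, hz0⟩ := hspec
  obtain ⟨χ, hχ⟩ := WeakDual.CharacterSpace.mem_spectrum_iff_exists.mp hz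
  let χ' : StrongDual ℂ S := WeakDual.toStrongDual (χ : WeakDual ℂ S)
  have hχn : ‖χ'‖ ≤ 1 := ContinuousLinearMap.opNorm_le_bound _ zero_le_one fun x => by
    rw [one_mul]
    exact spectrum.norm_le_norm_of_mem (AlgHom.apply_mem_spectrum χ x)
  obtain ⟨g, hg, hgn⟩ := exists_extension_norm_eq (S.toSubalgebra.toSubmodule) χ'
  exact ⟨g, ⟨hgn.trans_le hχn, (hg (1 : S)).trans (map_one χ)⟩,
    fun h => hz0 (((hg b').trans hχ).symm.trans h)⟩

lemma eq_zero_of_forall_isUnitalContraction {a : A}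
    (h : ∀ g : StrongDual ℂ A, IsUnitalContraction g → g a = 0) : a = 0 := by
  have h' : ∀ g : StrongDual ℂ A, IsUnitalContraction g → g (star a) = 0 := fun g hg => by
    rw [hg.map_star, h g hg, star_zero]
  have hsa : ∀ b : A, IsSelfAdjoint b →
      (∀ g : StrongDual ℂ A, IsUnitalContraction g → g b = 0) → b = 0 := fun b hb hgb => by
    by_contra hne
    obtain ⟨g, hg, hne⟩ := exists_isUnitalContraction_apply_ne_zero hb hne
    exact hne (hgb g hg)
  have hre : a + star a = 0 := hsa _ (IsSelfAdjoint.add_star_self a) fun g hg => by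
    rw [map_add, h g hg, h' g hg, add_zero]
  have him : Complex.I • (a - star a) = 0 := by
    refine hsa _ ?_ fun g hg => by rw [map_smul, map_sub, h g hg, h' g hg, sub_zero, smul_zero]
    rw [isSelfAdjoint_iff, star_smul, star_sub, star_star, Complex.star_def, Complex.conj_I,
      neg_smul, ← smul_neg, neg_sub]
  rw [smul_eq_zero_iff_right Complex.I_ne_zero, sub_eq_zero] at him
  rw [← him, ← two_smul ℂ] at hre
  exact (smul_eq_zero_iff_right two_ne_zero).mp hre

lemma exists_isUnitalContraction (A : Type*) [CStarAlgebra A] [Nontrivial A] :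
    ∃ g : StrongDual ℂ A, IsUnitalContraction g :=
  let ⟨g, hg, _⟩ := exists_isUnitalContraction_apply_ne_zero (.one A) one_ne_zero
  ⟨g, hg⟩

end States

namespace MinTensor

/-! ### Product functionals on the minimal tensor product -/

section Product
variable {A B C : Type*} [CStarAlgebra A] [CStarAlgebra B] [CStarAlgebra C]

lemma tmul_mul_tmul (a a' : A) (b b' : B) :
    (tmul a b * tmul a' b' : MinTensor A B) = tmul (a * a') (b * b') := by
  simp [tmul, ← map_mul]

lemma star_tmul (a : A) (b : B) : star (tmul a b : MinTensor A B) = tmul (star a) (star b) := by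
  simp [tmul, ← map_star]

lemma inl_apply (a : A) : inl A B a = tmul a 1 := rfl

variable (A B) in
/-- The `*`-homomorphism `b ↦ 1 ⊗ b`. -/
def inr : B →⋆ₐ[ℂ] MinTensor A B where
  toFun b := tmul 1 b
  map_one' := map_one (of A B)
  map_mul' b b' := by rw [tmul_mul_tmul, one_mul]
  map_zero' := by simp [tmul]
  map_add' b b' := by simp [tmul, TensorProduct.tmul_add]
  commutes' c := by
    rw [Algebra.algebraMap_eq_smul_one, tmul, TensorProduct.tmul_smul, map_smul,
      ← Algebra.TensorProduct.one_def, map_one, Algebra.algebraMap_eq_smul_one]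
  map_star' b := by rw [star_tmul, star_one]

lemma inr_apply (b : B) : inr A B b = tmul 1 b := rfl

/-- Bounded linear maps agreeing on elementary tensors agree. -/
lemma clm_ext {E : Type*} [NormedAddCommGroup E] [NormedSpace ℂ E] {f g : MinTensor A B →L[ℂ] E}
    (h : ∀ a b, f (tmul a b) = g (tmul a b)) : f = g := by
  ext t
  induction t using denseRange_of.induction_on with
  | hp => apply isClosed_eq <;> fun_prop
  | ih x =>
    induction x with
    | zero => simp
    | add x y hx hy => simp only [map_add, hx, hy]
    | tmul a b => exact h a b

lemma clm_ext_threefold {E : Type*} [NormedAddCommGroup E] [NormedSpace ℂ E]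
    {f g : MinTensor (MinTensor A B) C →L[ℂ] E}
    (h : ∀ a b c, f (tmul (tmul a b) c) = g (tmul (tmul a b) c)) : f = g := by
  ext t
  induction t using denseRange_ofLeft.induction_on with
  | hp => apply isClosed_eq <;> fun_prop
  | ih x =>
    induction x with
    | zero => simp
    | add x y hx hy => simp only [map_add, hx, hy]
    | tmul x c =>
      induction x with
      | zero => simp
      | add x y hx hy => simp only [TensorProduct.add_tmul, map_add, hx, hy]
      | tmul a b => exact h a b c

lemma norm_sliceLeft_le (μ : A →L[ℂ] ℂ) : ‖sliceLeft B μ‖ ≤ ‖μ‖ :=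
  LinearMap.opNorm_extendOfNorm_le denseRange_of (norm_nonneg _) (norm_algSliceLeft_le μ)

lemma norm_algSliceRight_le (ν : B →L[ℂ] ℂ) (x : A ⊗[ℂ] B) :
    ‖algSliceRight A (ν : B →ₗ[ℂ] ℂ) x‖ ≤ ‖ν‖ * ‖of A B x‖ := by
  have h : algSliceRight A (ν : B →ₗ[ℂ] ℂ) x
      = algSliceLeft A (ν : B →ₗ[ℂ] ℂ) (TensorProduct.comm ℂ A B x) := by
    induction x with
    | zero => simp
    | add x y hx hy => simp only [map_add, hx, hy]
    | tmul a b => simp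
  rw [h]
  refine (norm_algSliceLeft_le ν _).trans_eq ?_
  rw [norm_of, norm_of, norm_tensorOp_comm]

variable (A) in
/-- The slice map `id ⊗ ν`, the bounded linear extension of `a ⊗ b ↦ ν b • a`. -/
def sliceRight (ν : B →L[ℂ] ℂ) : MinTensor A B →L[ℂ] A :=
  (algSliceRight A (ν : B →ₗ[ℂ] ℂ)).extendOfNorm (of A B : A ⊗[ℂ] B →ₗ[ℂ] MinTensor A B)

@[simp] lemma sliceRight_tmul (ν : B →L[ℂ] ℂ) (a : A) (b : B) :
    sliceRight A ν (tmul a b) = ν b • a :=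
  (LinearMap.extendOfNorm_eq (e := (of A B : A ⊗[ℂ] B →ₗ[ℂ] MinTensor A B)) denseRange_of
    ⟨‖ν‖, norm_algSliceRight_le ν⟩ (a ⊗ₜ b)).trans (algSliceRight_tmul _ a b)

lemma norm_sliceRight_le (ν : B →L[ℂ] ℂ) : ‖sliceRight A ν‖ ≤ ‖ν‖ :=
  LinearMap.opNorm_extendOfNorm_le denseRange_of (norm_nonneg _) (norm_algSliceRight_le ν)

/-- The product functional `μ ⊗ ν`. -/
def prodFun (μ : A →L[ℂ] ℂ) (ν : B →L[ℂ] ℂ) : MinTensor A B →L[ℂ] ℂ := ν.comp (sliceLeft B μ)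

variable (μ : A →L[ℂ] ℂ) (ν : B →L[ℂ] ℂ)

@[simp] lemma prodFun_tmul (a : A) (b : B) : prodFun μ ν (tmul a b) = μ a * ν b := by
  simp [prodFun]

lemma prodFun_eq_sliceLeft (t : MinTensor A B) : prodFun μ ν t = ν (sliceLeft B μ t) := rfl

lemma prodFun_eq_sliceRight (t : MinTensor A B) : prodFun μ ν t = μ (sliceRight A ν t) :=
  DFunLike.congr_fun (clm_ext (g := μ.comp (sliceRight A ν)) fun a b => by simp [mul_comm]) t

lemma norm_prodFun_le : ‖prodFun μ ν‖ ≤ ‖μ‖ * ‖ν‖ := by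
  rw [mul_comm]
  exact (ContinuousLinearMap.opNorm_comp_le _ _).trans (by gcongr; exact norm_sliceLeft_le μ)

lemma _root_.IsUnitalContraction.prodFun {μ : A →L[ℂ] ℂ} {ν : B →L[ℂ] ℂ}
    (hμ : IsUnitalContraction μ) (hν : IsUnitalContraction ν) :
    IsUnitalContraction (prodFun μ ν) := by
  refine ⟨(norm_prodFun_le μ ν).trans (mul_le_one₀ hμ.1 (norm_nonneg _) hν.1), ?_⟩
  rw [← map_one (inl A B), inl_apply, prodFun_tmul, hμ.2, hν.2, one_mul]

/-- The functional `a ↦ μ (c * a)`. -/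
def mulLeftFun (c : A) (μ : A →L[ℂ] ℂ) : A →L[ℂ] ℂ := μ.comp (ContinuousLinearMap.mul ℂ A c)

@[simp] lemma mulLeftFun_apply (c a : A) : mulLeftFun c μ a = μ (c * a) := rfl

lemma prodFun_inl_mul (c : A) (t : MinTensor A B) :
    prodFun μ ν (inl A B c * t) = prodFun (mulLeftFun c μ) ν t :=
  DFunLike.congr_fun (clm_ext (f := (prodFun μ ν).comp (ContinuousLinearMap.mul ℂ _ (inl A B c)))
    fun a b => by simp [inl_apply, tmul_mul_tmul]) t

lemma prodFun_inr_mul (c : B) (t : MinTensor A B) :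
    prodFun μ ν (inr A B c * t) = prodFun μ (mulLeftFun c ν) t :=
  DFunLike.congr_fun (clm_ext (f := (prodFun μ ν).comp (ContinuousLinearMap.mul ℂ _ (inr A B c)))
    fun a b => by simp [inr_apply, tmul_mul_tmul]) t

/-- The vector functional `a ↦ ⟪h, π a h'⟫`, as a bounded functional. -/
def vecDual {H : Type*} [NormedAddCommGroup H] [InnerProductSpace ℂ H] [CompleteSpace H]
    (π : A →⋆ₐ[ℂ] (H →L[ℂ] H)) (h h' : H) : A →L[ℂ] ℂ :=
  (vecFun π h h').mkContinuous (‖h‖ * ‖h'‖) fun a => by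
    calc ‖⟪h, π a h'⟫_ℂ‖ ≤ ‖h‖ * ‖π a h'‖ := norm_inner_le_norm _ _
      _ ≤ ‖h‖ * (‖a‖ * ‖h'‖) := by gcongr; exact norm_rep_apply_le π a h'
      _ = _ := by ring

/-- Product functionals separate the points of the minimal tensor product: in the defining
representation, matrix coefficients between elementary tensors are products of vector functionals. -/
lemma eq_of_forall_prodFun {s t : MinTensor A B}
    (h : ∀ (μ : A →L[ℂ] ℂ) (ν : B →L[ℂ] ℂ), prodFun μ ν s = prodFun μ ν t) : s = t := by
  have key : ∀ (x x' : UnivSpace A) (y y' : UnivSpace B),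
      vecDual (incl A B) (x ⊗ₜ[ℂ] y : UnivSpace A ⊗[ℂ] UnivSpace B)
        (x' ⊗ₜ[ℂ] y' : UnivSpace A ⊗[ℂ] UnivSpace B)
        = prodFun (vecDual (univRep A) x x') (vecDual (univRep B) y y') := fun x x' y y' =>
    clm_ext fun a b => by
      change ⟪_, incl A B (of A B (a ⊗ₜ b)) _⟫_ℂ = _
      rw [incl_of, tensorRep_coe, Completion.inner_coe, tensorOp_tmul, TensorProduct.inner_tmul,
        prodFun_tmul]
      rfl
  have coeff : ∀ ξ η : UnivSpace A ⊗[ℂ] UnivSpace B,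
      ⟪(ξ : Completion (UnivSpace A ⊗[ℂ] UnivSpace B)), incl A B s η⟫_ℂ
        = ⟪(ξ : Completion (UnivSpace A ⊗[ℂ] UnivSpace B)), incl A B t η⟫_ℂ := by
    intro ξ η
    induction ξ with
    | zero => rw [Completion.coe_zero, inner_zero_left, inner_zero_left]
    | add ξ ξ' hξ hξ' => simp only [Completion.coe_add, inner_add_left, hξ, hξ']
    | tmul x y =>
      induction η with
      | zero => simp only [Completion.coe_zero, map_zero]
      | add η η' hη hη' => simp only [Completion.coe_add, map_add, inner_add_right, hη, hη']
      | tmul x' y' =>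
        have := h (vecDual (univRep A) x x') (vecDual (univRep B) y y')
        rwa [← key] at this
  apply incl_injective
  ext η
  refine ext_inner_left ℂ fun ξ => ?_
  induction ξ, η using Completion.induction_on₂ with
  | hp => apply isClosed_eq <;> fun_prop
  | ih ξ η => exact coeff ξ η

lemma prodFun_prodFun (ρ : C →L[ℂ] ℂ) (t : MinTensor (MinTensor A B) C) :
    prodFun (prodFun μ ν) ρ t = prodFun μ (prodFun ν ρ) (assoc A B C t) :=
  DFunLike.congr_fun (clm_ext_threefold (g := (prodFun μ (prodFun ν ρ)).comp (assoc A B C))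
    fun a b c => by simp [mul_assoc]) t

variable (A B) in
/-- The bilinear map `(μ, ν) ↦ μ ⊗ ν`. -/
def prodFunₗ : (A →L[ℂ] ℂ) →ₗ[ℂ] (B →L[ℂ] ℂ) →ₗ[ℂ] (MinTensor A B →L[ℂ] ℂ) :=
  LinearMap.mk₂ ℂ prodFun
    (fun μ μ' ν => clm_ext fun a b => by simp [add_mul])
    (fun c μ ν => clm_ext fun a b => by simp [mul_assoc])
    (fun μ ν ν' => clm_ext fun a b => by simp [mul_add])
    (fun c μ ν => clm_ext fun a b => by simp [mul_left_comm])

@[simp] lemma prodFunₗ_apply : prodFunₗ A B μ ν = prodFun μ ν := rfl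

end Product

section Map
variable {A A' B C : Type*} [CStarAlgebra A] [CStarAlgebra A'] [CStarAlgebra B] [CStarAlgebra C]

/-- A `*`-homomorphism of C⋆-algebras as a bounded linear map. -/
def starHomCLM (φ : A →⋆ₐ[ℂ] B) : A →L[ℂ] B := 
  φ.toAlgHom.toLinearMap.mkContinuous 1 fun a => by
    rw [one_mul]
    exact NonUnitalStarAlgHom.norm_apply_le φ a

@[simp] lemma starHomCLM_apply (φ : A →⋆ₐ[ℂ] B) (a : A) : starHomCLM φ a = φ a := rfl

lemma _root_.IsUnitalContraction.comp_starHom {g : B →L[ℂ] ℂ} (hg : IsUnitalContraction g)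
    (φ : A →⋆ₐ[ℂ] B) : IsUnitalContraction (g.comp (starHomCLM φ)) := by
  refine ⟨ContinuousLinearMap.opNorm_le_bound _ zero_le_one fun a => ?_, ?_⟩
  · rw [one_mul]
    refine (g.le_of_opNorm_le hg.1 _).trans ?_
    rw [one_mul]
    exact NonUnitalStarAlgHom.norm_apply_le φ a
  · simp [hg.2]

lemma prodFun_map_left (f : A →⋆ₐ[ℂ] A') (μ : A' →L[ℂ] ℂ) (ν : B →L[ℂ] ℂ) (t : MinTensor A B) :
    prodFun μ ν (map f (StarAlgHom.id ℂ B) t) = prodFun (μ.comp (starHomCLM f)) ν t :=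
  DFunLike.congr_fun (clm_ext (f := (prodFun μ ν).comp (map f (StarAlgHom.id ℂ B)))
    fun a b => by simp) t

lemma prodFun_map_right (f : B →⋆ₐ[ℂ] C) (μ : A →L[ℂ] ℂ) (ν : C →L[ℂ] ℂ) (t : MinTensor A B) :
    prodFun μ ν (map (StarAlgHom.id ℂ A) f t) = prodFun μ (ν.comp (starHomCLM f)) t :=
  DFunLike.congr_fun (clm_ext (f := (prodFun μ ν).comp (map (StarAlgHom.id ℂ A) f))
    fun a b => by simp) t

end Map

end MinTensor

/-! ### Weak-* compactness of the state space -/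

section Compactness
variable {A : Type*} [CStarAlgebra A]

lemma isCompact_setOf_isUnitalContraction :
    IsCompact {g : WeakDual ℂ A | IsUnitalContraction (WeakDual.toStrongDual g)} := by
  have h := (WeakDual.isCompact_closedBall (0 : StrongDual ℂ A) 1).inter_right
    (isClosed_eq (WeakDual.eval_continuous (𝕜 := ℂ) (1 : A)) continuous_const :
      IsClosed {g : WeakDual ℂ A | g 1 = 1})
  convert h using 1
  ext g
  simp [IsUnitalContraction]

/-- Averages of finitely many states are states. -/
lemma isUnitalContraction_average {ι : Type*} {s : Finset ι} (hs : s.Nonempty)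
    {ρ : ι → StrongDual ℂ A} (hρ : ∀ i ∈ s, IsUnitalContraction (ρ i)) :
    IsUnitalContraction ((s.card : ℂ)⁻¹ • ∑ i ∈ s, ρ i) := by
  have hc : (s.card : ℝ) ≠ 0 := by exact_mod_cast hs.card_ne_zero
  constructor
  · rw [norm_smul, norm_inv, Complex.norm_natCast]
    have h : ‖∑ i ∈ s, ρ i‖ ≤ s.card := by
      refine (norm_sum_le_of_le s fun i hi => (hρ i hi).1).trans ?_
      simp
    calc _ ≤ (s.card : ℝ)⁻¹ * s.card := by gcongr
      _ = 1 := inv_mul_cancel₀ hc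
  · have h : (∑ i ∈ s, ρ i) 1 = s.card := by
      rw [sum_apply, Finset.sum_congr rfl fun i hi => (hρ i hi).2]
      simp
    rw [smul_apply, h, smul_eq_mul,
      inv_mul_cancel₀ (by exact_mod_cast hs.card_ne_zero)]

end Compactness

namespace CompactQuantumGroup
open MinTensor

/-! ### Convolution of functionals -/

namespace Action
variable {A : Type u} [CStarAlgebra A] {G : CompactQuantumGroup A}
  {B : Type v} [CStarAlgebra B] (α : G.Action B)

/-- The convolution `(μ ⊗ ν) ∘ α` of a functional on `B` with a functional on `A`, as a bilinear
map. -/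
def conv : StrongDual ℂ B →ₗ[ℂ] StrongDual ℂ A →ₗ[ℂ] StrongDual ℂ B :=
  (prodFunₗ B A).compr₂ (ContinuousLinearMap.precomp ℂ (starHomCLM α.coact)).toLinearMap

@[simp] lemma conv_apply (μ : StrongDual ℂ B) (ν : StrongDual ℂ A) (b : B) :
    α.conv μ ν b = prodFun μ ν (α.coact b) := rfl

lemma isUnitalContraction_conv {μ : StrongDual ℂ B} {ν : StrongDual ℂ A}
    (hμ : IsUnitalContraction μ) (hν : IsUnitalContraction ν) :
    IsUnitalContraction (α.conv μ ν) :=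
  (hμ.prodFun hν).comp_starHom α.coact

end Action

variable {A : Type u} [CStarAlgebra A] (G : CompactQuantumGroup A)

/-- The action of a compact quantum group on itself by translation. -/
def translation : G.Action A := ⟨G.comul, G.coassoc, G.dense_right⟩

/-- The convolution `(μ ⊗ ν) ∘ Δ` of two functionals on `A`, as a bilinear map. -/
abbrev conv : StrongDual ℂ A →ₗ[ℂ] StrongDual ℂ A →ₗ[ℂ] StrongDual ℂ A := G.translation.conv

lemma conv_apply (μ ν : StrongDual ℂ A) (a : A) : G.conv μ ν a = prodFun μ ν (G.comul a) := rfl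

variable {G} in
lemma Action.conv_conv {B : Type v} [CStarAlgebra B] (α : G.Action B) (μ : StrongDual ℂ B)
    (ν ρ : StrongDual ℂ A) : α.conv (α.conv μ ν) ρ = α.conv μ (G.conv ν ρ) := by
  ext b
  have h := congrArg (prodFun μ (prodFun ν ρ)) (α.coassoc b)
  rwa [← prodFun_prodFun, prodFun_map_left, prodFun_map_right] at h

/-! ### The Haar state -/

/-- Every state `ω` has a state `h` with `ω * h = h = h * ω`, namely any weak-* cluster point
of the Cesàro means of the convolution powers of `ω`. -/
lemma exists_conv_eq_self {ω : StrongDual ℂ A} (hω : IsUnitalContraction ω) :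
    ∃ h : StrongDual ℂ A, IsUnitalContraction h ∧ G.conv ω h = h ∧ G.conv h ω = h := by
  let p : ℕ → StrongDual ℂ A := fun n => (G.conv ω)^[n] ω
  have p_succ : ∀ n, p (n + 1) = G.conv ω (p n) := fun n => Function.iterate_succ_apply' _ _ _
  have p_succ' : ∀ n, p (n + 1) = G.conv (p n) ω := by
    intro n
    induction n with
    | zero => rfl
    | succ n ih => rw [p_succ (n + 1), p_succ n, G.translation.conv_conv, ← ih, p_succ n]
  have hp : ∀ n, IsUnitalContraction (p n) := by
    intro n
    induction n with
    | zero => exact hω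
    | succ n ih => rw [p_succ]; exact G.translation.isUnitalContraction_conv hω ih
  let m : ℕ → StrongDual ℂ A := fun n =>
    ((Finset.range (n + 1)).card : ℂ)⁻¹ • ∑ k ∈ Finset.range (n + 1), p k
  have hm : ∀ n, IsUnitalContraction (m n) := fun n =>
    isUnitalContraction_average (by simp) fun i _ => hp i
  -- translating a mean by `ω` changes it by the difference of the two end terms only
  have shift : ∀ f : StrongDual ℂ A →ₗ[ℂ] StrongDual ℂ A, (∀ n, f (p n) = p (n + 1)) →
      ∀ a, Tendsto (fun n => f (m n) a - m n a) atTop (𝓝 0) := by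
    intro f hf a
    refine squeeze_zero_norm (a := fun n : ℕ => 2 * ‖a‖ * (1 / ((n : ℝ) + 1))) (fun n => ?_) ?_
    · have h1 : f (m n) a - m n a = ((n : ℂ) + 1)⁻¹ * (p (n + 1) a - p 0 a) := by
        have h2 : f (m n) - m n = ((n : ℂ) + 1)⁻¹ • (p (n + 1) - p 0) := by
          rw [← Finset.sum_range_sub p (n + 1), Finset.sum_sub_distrib]
          simp only [m, map_smul, map_sum, hf, smul_sub, Finset.card_range, Nat.cast_add,
            Nat.cast_one]
        simpa using DFunLike.congr_fun h2 a
      have h3 : ∀ k, ‖p k a‖ ≤ ‖a‖ := fun k => by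
        simpa using (p k).le_of_opNorm_le (hp k).1 a
      have h4 : ‖(n : ℂ) + 1‖ = (n : ℝ) + 1 := by
        have := Complex.norm_natCast (n + 1)
        push_cast at this
        exact this
      rw [h1, norm_mul, norm_inv, h4, one_div, mul_comm]
      gcongr
      exact (norm_sub_le _ _).trans (by linarith [h3 (n + 1), h3 0])
    · simpa using (tendsto_one_div_add_atTop_nhds_zero_nat (𝕜 := ℝ)).const_mul (2 * ‖a‖)
  let U : Ultrafilter ℕ := hyperfilter ℕ
  have hU : (U : Filter ℕ) ≤ atTop := Nat.hyperfilter_le_atTop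
  obtain ⟨h, hh, hlim⟩ := isCompact_setOf_isUnitalContraction.ultrafilter_le_nhds
    (U.map fun n => StrongDual.toWeakDual (m n))
    (Filter.le_principal_iff.mpr (Filter.univ_mem' (f := (U : Filter ℕ)) hm))
  have hlim' : ∀ a, Tendsto (fun n => m n a) U (𝓝 (h a)) := fun a =>
    ((WeakDual.eval_continuous (𝕜 := ℂ) a).tendsto h).comp hlim
  -- `f` is weak-* continuous in the sense that it is dual to a map of `A`
  have fixed : ∀ f : StrongDual ℂ A →ₗ[ℂ] StrongDual ℂ A, (∀ n, f (p n) = p (n + 1)) →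
      (∀ a, ∃ b, ∀ μ, f μ a = μ b) → f (WeakDual.toStrongDual h) = WeakDual.toStrongDual h := by
    intro f hf hdual
    ext a
    obtain ⟨b, hb⟩ := hdual a
    have h1 : Tendsto (fun n => m n b) U (𝓝 (h a)) := by
      simpa [← hb] using ((shift f hf a).mono_left hU).add (hlim' a)
    rw [hb]
    exact tendsto_nhds_unique (hlim' b) h1
  exact ⟨WeakDual.toStrongDual h, hh,
    fixed (G.conv ω) (fun n => (p_succ n).symm) fun a => ⟨sliceLeft A ω (G.comul a), fun μ => rfl⟩,
    fixed (G.conv.flip ω) (fun n => (p_succ' n).symm) fun a =>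
      ⟨sliceRight A ω (G.comul a), fun μ => prodFun_eq_sliceRight μ ω _⟩⟩

/-- The key step towards the Haar state: if `h` absorbs an average `ω` of states
from both sides, it absorbs each of them. With `b` the slice of `Δ a` by `h`, the state `h ⊗ ω`
annihilates `|Δ b - b ⊗ 1|²`, hence so does each `h ⊗ ρ i`; the Cauchy–Schwarz inequality and
density turn this into `ρ i * h = h`. The pairing `P` is `(μ, ν) ↦ μ ⊗ ν` with `j a = a ⊗ 1`, or
`(μ, ν) ↦ ν ⊗ μ` with `j a = 1 ⊗ a`, which gives the statement for either order of convolution. -/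
lemma absorb_of_absorb_average {D : Type*} [CStarAlgebra D] (Δ j k : A →⋆ₐ[ℂ] D)
    (P : StrongDual ℂ A →ₗ[ℂ] StrongDual ℂ A →ₗ[ℂ] StrongDual ℂ D)
    (P_state : ∀ μ ν, IsUnitalContraction μ → IsUnitalContraction ν → IsUnitalContraction (P μ ν))
    (P_mul : ∀ μ ν c t, P μ ν (j c * t) = P (mulLeftFun c μ) ν t)
    (P_j : ∀ μ ν c, P μ ν (j c) = μ c * ν 1) (P_k : ∀ μ ν d, P μ ν (k d) = μ 1 * ν d)
    (conv : StrongDual ℂ A → StrongDual ℂ A → StrongDual ℂ A)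
    (conv_eq : ∀ μ ν a, conv μ ν a = P μ ν (Δ a))
    (assoc : ∀ μ ν ρ, conv (conv μ ν) ρ = conv μ (conv ν ρ))
    (slice : ∀ ν a, ∃ b, ∀ μ, μ b = P μ ν (Δ a))
    (dense : Dense (Submodule.span ℂ {x | ∃ c a, x = j c * Δ a} : Set D))
    {ι : Type*} {s : Finset ι} (hs : s.Nonempty) {ρ : ι → StrongDual ℂ A}
    (hρ : ∀ i ∈ s, IsUnitalContraction (ρ i)) {h : StrongDual ℂ A} (hh : IsUnitalContraction h)
    (left : conv ((s.card : ℂ)⁻¹ • ∑ i ∈ s, ρ i) h = h)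
    (right : conv h ((s.card : ℂ)⁻¹ • ∑ i ∈ s, ρ i) = h) {i : ι} (hi : i ∈ s) :
    conv (ρ i) h = h := by
  have hω := isUnitalContraction_average hs hρ
  set ω := (s.card : ℂ)⁻¹ • ∑ i ∈ s, ρ i with ω_def
  have hΦ := P_state _ _ hh hω
  have agree : ∀ c a, P h (conv (ρ i) h) (j c * Δ a) = P h h (j c * Δ a) := by
    intro c a
    obtain ⟨b, hb⟩ := slice h a
    have swap : ∀ μ ν, P μ ν (Δ b) = P μ (conv ν h) (Δ a) := fun μ ν => by
      rw [← conv_eq, hb, ← conv_eq, assoc, conv_eq]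
    have hq : star (h (star b * b)) = h (star b * b) := by
      rw [← hh.map_star, star_mul, star_star]
    have h1 : P h ω (j (star b) * Δ b) = h (star b * b) := by
      rw [P_mul, swap, left, ← hb, mulLeftFun_apply]
    have h2 : P h ω (star (Δ b) * j b) = h (star b * b) := by
      rw [← hq, ← h1, ← hΦ.map_star, star_mul, ← map_star j, star_star]
    have h3 : P h ω (star (Δ b - j b) * (Δ b - j b)) = 0 := by
      have e : star (Δ b - j b) * (Δ b - j b)
          = Δ (star b * b) - star (Δ b) * j b - j (star b) * Δ b + j (star b * b) := by
        simp only [star_sub, sub_mul, mul_sub, map_mul, map_star]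
        abel
      rw [e, map_add, map_sub, map_sub, h1, h2, P_j, ← conv_eq, right, hω.2]
      ring
    have h4 : P h (ρ i) (star (Δ b - j b) * (Δ b - j b)) = 0 := by
      have hc : (s.card : ℂ)⁻¹ ≠ 0 := inv_ne_zero (by exact_mod_cast hs.card_ne_zero)
      rw [ω_def, map_smul, map_sum, smul_apply, smul_eq_zero_iff_right hc,
        sum_apply, Finset.sum_eq_zero_iff_of_nonneg
          fun i hi => (P_state _ _ hh (hρ i hi)).isState.1 _] at h3
      exact h3 i hi
    have h5 := (P_state _ _ hh (hρ i hi)).map_mul_eq_zero h4 (j c)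
    rw [mul_sub, map_sub, sub_eq_zero, P_mul, swap, ← map_mul, P_j, (hρ i hi).2, mul_one] at h5
    rw [P_mul, h5, P_mul, ← hb, mulLeftFun_apply]
  have heq : P h (conv (ρ i) h) = P h h :=
    ContinuousLinearMap.ext_on dense (by rintro _ ⟨c, a, rfl⟩; exact agree c a)
  ext d
  have := DFunLike.congr_fun heq (k d)
  rwa [P_k, P_k, hh.2, one_mul, one_mul] at this

lemma dense_span_star {D : Type*} [CStarAlgebra D] {S T : Set D}
    (hS : Dense (Submodule.span ℂ S : Set D)) (hST : ∀ x ∈ S, star x ∈ T) :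
    Dense (Submodule.span ℂ T : Set D) := by
  refine (star_involutive.surjective.denseRange.dense_image continuous_star hS).mono ?_
  rintro _ ⟨x, hx, rfl⟩
  induction hx using Submodule.span_induction with
  | mem x hx => exact Submodule.subset_span (hST x hx)
  | zero => simp
  | add x y _ _ hx hy => rw [star_add]; exact add_mem hx hy
  | smul c x _ hx => rw [star_smul]; exact Submodule.smul_mem _ _ hx

lemma conv_eq_self_of_average {ι : Type*} {s : Finset ι} (hs : s.Nonempty)
    {ρ : ι → StrongDual ℂ A} (hρ : ∀ i ∈ s, IsUnitalContraction (ρ i)) {h : StrongDual ℂ A}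
    (hh : IsUnitalContraction h) (left : G.conv ((s.card : ℂ)⁻¹ • ∑ i ∈ s, ρ i) h = h)
    (right : G.conv h ((s.card : ℂ)⁻¹ • ∑ i ∈ s, ρ i) = h) {i : ι} (hi : i ∈ s) :
    G.conv (ρ i) h = h ∧ G.conv h (ρ i) = h := by
  constructor
  · refine absorb_of_absorb_average G.comul (inl A A) (inr A A) (prodFunₗ A A)
      (fun _ _ => IsUnitalContraction.prodFun) (fun μ ν c t => prodFun_inl_mul μ ν c t)
      (fun μ ν c => prodFun_tmul μ ν c 1) (fun μ ν d => prodFun_tmul μ ν 1 d)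
      (fun μ ν => G.conv μ ν) (fun _ _ _ => rfl) (fun μ ν ρ => G.translation.conv_conv μ ν ρ)
      (fun ν a => ⟨sliceRight A ν (G.comul a), fun μ => (prodFun_eq_sliceRight μ ν _).symm⟩)
      (dense_span_star G.dense_left ?_) hs hρ hh left right hi
    rintro _ ⟨a, b, rfl⟩
    exact ⟨star b, star a, by rw [star_mul, inl_apply, star_tmul, star_one, map_star]⟩
  · refine absorb_of_absorb_average G.comul (inr A A) (inl A A) (prodFunₗ A A).flip
      (fun _ _ hμ hν => hν.prodFun hμ) (fun μ ν c t => prodFun_inr_mul ν μ c t)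
      (fun μ ν c => (prodFun_tmul ν μ 1 c).trans (mul_comm _ _))
      (fun μ ν d => (prodFun_tmul ν μ d 1).trans (mul_comm _ _))
      (fun μ ν => G.conv ν μ) (fun _ _ _ => rfl)
      (fun μ ν ρ => (G.translation.conv_conv ρ ν μ).symm)
      (fun ν a => ⟨sliceLeft A ν (G.comul a), fun μ => rfl⟩)
      (dense_span_star G.dense_right ?_) hs hρ hh right left hi
    rintro _ ⟨a, b, rfl⟩
    exact ⟨star b, star a, by rw [star_mul, inr_apply, star_tmul, star_one, map_star]⟩

/-- Existence of the Haar state: the weak-* closed sets of states absorbed by a given state have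
the finite intersection property, and states separate points. -/
theorem exists_haar [Nontrivial A] : ∃ h : StrongDual ℂ A, IsUnitalContraction h ∧
    ∀ ν : StrongDual ℂ A, G.conv ν h = ν 1 • h ∧ G.conv h ν = ν 1 • h := by
  let t : {ρ : StrongDual ℂ A // IsUnitalContraction ρ} → Set (WeakDual ℂ A) := fun ρ =>
    {h | ∀ a, h (sliceLeft A ρ.1 (G.comul a)) = h a ∧ h (sliceRight A ρ.1 (G.comul a)) = h a}
  have ht : ∀ ρ h, h ∈ t ρ ↔ G.conv ρ.1 (WeakDual.toStrongDual h) = WeakDual.toStrongDual h ∧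
      G.conv (WeakDual.toStrongDual h) ρ.1 = WeakDual.toStrongDual h := by
    intro ρ h
    simp only [ContinuousLinearMap.ext_iff, ← forall_and, conv_apply]
    refine forall_congr' fun a => ?_
    rw [prodFun_eq_sliceLeft, prodFun_eq_sliceRight]
    rfl
  have closed : ∀ ρ, IsClosed (t ρ) := by
    intro ρ
    simp only [t, Set.ofPred_forall, Set.ofPred_and]
    exact isClosed_iInter fun a =>
      (isClosed_eq (WeakDual.eval_continuous _) (WeakDual.eval_continuous _)).inter
        (isClosed_eq (WeakDual.eval_continuous _) (WeakDual.eval_continuous _))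
  obtain ⟨h, hh, hmem⟩ := isCompact_setOf_isUnitalContraction.inter_iInter_nonempty t closed (by
    intro s
    rcases s.eq_empty_or_nonempty with rfl | hs
    · obtain ⟨g, hg⟩ := exists_isUnitalContraction A
      exact ⟨StrongDual.toWeakDual g, hg, by simp⟩
    · obtain ⟨h, hh, h1, h2⟩ := G.exists_conv_eq_self
        (isUnitalContraction_average hs fun ρ _ => ρ.2)
      refine ⟨StrongDual.toWeakDual h, hh, Set.mem_iInter₂.mpr fun ρ hρ => (ht ρ _).mpr ?_⟩
      exact G.conv_eq_self_of_average hs (fun ρ _ => ρ.2) hh h1 h2 hρ)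
  rw [Set.mem_iInter] at hmem
  set h' : StrongDual ℂ A := WeakDual.toStrongDual h with h'_def
  have right : ∀ a, sliceRight A h' (G.comul a) = h' a • 1 := fun a =>
    sub_eq_zero.mp <| eq_zero_of_forall_isUnitalContraction fun g hg => by
      have := DFunLike.congr_fun ((ht ⟨g, hg⟩ h).mp (hmem ⟨g, hg⟩)).1 a
      rw [conv_apply, prodFun_eq_sliceRight] at this
      rw [map_sub, this, map_smul, hg.2, smul_eq_mul, mul_one, sub_self]
  have left : ∀ a, sliceLeft A h' (G.comul a) = h' a • 1 := fun a =>
    sub_eq_zero.mp <| eq_zero_of_forall_isUnitalContraction fun g hg => by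
      have := DFunLike.congr_fun ((ht ⟨g, hg⟩ h).mp (hmem ⟨g, hg⟩)).2 a
      rw [conv_apply, prodFun_eq_sliceLeft] at this
      rw [map_sub, this, map_smul, hg.2, smul_eq_mul, mul_one, sub_self]
  refine ⟨h', hh, fun ν => ⟨?_, ?_⟩⟩
  · ext a
    rw [conv_apply, prodFun_eq_sliceRight, right, map_smul, smul_eq_mul, mul_comm]
    rfl
  · ext a
    rw [conv_apply, prodFun_eq_sliceLeft, left, map_smul, smul_eq_mul, mul_comm]
    rfl

end CompactQuantumGroup

namespace CompactQuantumGroup.Action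
open MinTensor
variable {A : Type u} [CStarAlgebra A] {G : CompactQuantumGroup A}
  {B : Type v} [CStarAlgebra B] (α : G.Action B)

/-! ### The conditional expectation onto the fixed-point algebra -/

lemma mem_fixedPoints {b : B} : b ∈ α.fixedPoints ↔ α.coact b = tmul b 1 := Iff.rfl

lemma isInvariant_iff {μ : StrongDual ℂ B} :
    α.IsInvariant μ ↔ ∀ ν : StrongDual ℂ A, α.conv μ ν = ν 1 • μ := by
  constructor
  · intro h ν
    ext b
    rw [conv_apply, prodFun_eq_sliceLeft, h b, map_smul, smul_eq_mul, mul_comm]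
    rfl
  · intro h b
    refine sub_eq_zero.mp <| eq_zero_of_forall_isUnitalContraction fun ν _ => ?_
    have := DFunLike.congr_fun (h ν) b
    rw [conv_apply, prodFun_eq_sliceLeft] at this
    rw [map_sub, this, map_smul, smul_apply, smul_eq_mul, smul_eq_mul, mul_comm, sub_self]

/-- Averaging over the quantum group, `E = (id ⊗ h) ∘ α` with `h` the Haar state, is a contractive
projection onto the fixed-point algebra, and the invariant functionals are those that factor
through it. If `A = 0` there is no Haar state, but then every element is fixed and `E = id` will
do. -/
theorem exists_conditionalExpectation : ∃ E : B →L[ℂ] B, ‖E‖ ≤ 1 ∧ (∀ b, E b ∈ α.fixedPoints) ∧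
    (∀ b ∈ α.fixedPoints, E b = b) ∧ (∀ μ : StrongDual ℂ B, α.IsInvariant (μ.comp E)) ∧
    ∀ μ : StrongDual ℂ B, α.IsInvariant μ → μ.comp E = μ := by
  rcases subsingleton_or_nontrivial A with hA | hA
  · refine ⟨.id ℂ B, ContinuousLinearMap.norm_id_le, fun b => ?_, fun _ _ => rfl,
      fun μ b => Subsingleton.elim _ _, fun μ _ => μ.comp_id⟩
    refine α.mem_fixedPoints.mpr (eq_of_forall_prodFun fun μ ν => ?_)
    rw [Subsingleton.elim ν 0, prodFun_eq_sliceLeft, prodFun_eq_sliceLeft]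
    rfl
  obtain ⟨h, hh, hconv⟩ := G.exists_haar
  let E : B →L[ℂ] B := (sliceRight B h).comp (starHomCLM α.coact)
  have hE : ∀ μ : StrongDual ℂ B, μ.comp E = α.conv μ h := fun μ => by
    ext b
    exact (prodFun_eq_sliceRight μ h _).symm
  refine ⟨E, ContinuousLinearMap.opNorm_le_bound _ zero_le_one fun b => ?_, fun b => ?_,
    fun b hb => ?_, fun μ => ?_, fun μ hμ => ?_⟩
  · rw [one_mul]
    refine ((sliceRight B h).le_of_opNorm_le ((norm_sliceRight_le h).trans hh.1) _).trans ?_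
    rw [one_mul]
    exact NonUnitalStarAlgHom.norm_apply_le α.coact b
  · refine α.mem_fixedPoints.mpr (eq_of_forall_prodFun fun μ ν => ?_)
    have h1 : α.conv (α.conv μ ν) h = ν 1 • α.conv μ h := by
      rw [α.conv_conv, (hconv ν).1, map_smul]
    rw [← hE, ← hE] at h1
    have h2 := DFunLike.congr_fun h1 b
    rw [prodFun_tmul, mul_comm]
    exact h2
  · change sliceRight B h (α.coact b) = b
    rw [α.mem_fixedPoints.mp hb, sliceRight_tmul, hh.2, one_smul]
  · rw [hE, isInvariant_iff]
    intro ν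
    rw [α.conv_conv, (hconv ν).2, map_smul]
  · rw [hE, α.isInvariant_iff.mp hμ, hh.2, one_smul]

/-! ### Invariant functionals and ergodicity -/

theorem restrict_isometry : Isometry α.restrict := by
  obtain ⟨E, hE1, hEmem, -, -, hEinv⟩ := α.exists_conditionalExpectation
  refine AddMonoidHomClass.isometry_of_norm α.restrict fun ψ : α.invariantFunctionals => le_antisymm
    (ContinuousLinearMap.opNorm_le_bound _ (norm_nonneg _) fun b => ?_)
    ((ContinuousLinearMap.opNorm_le_bound (ψ : StrongDual ℂ B) (norm_nonneg _) fun b => ?_ :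
      ‖(ψ : StrongDual ℂ B)‖ ≤ ‖α.restrict ψ‖))
  · exact (ψ : StrongDual ℂ B).le_opNorm b
  · have h1 : (ψ : StrongDual ℂ B) b = α.restrict ψ ⟨E b, hEmem b⟩ :=
      (DFunLike.congr_fun (hEinv ψ ψ.2) b).symm
    rw [h1]
    refine (ContinuousLinearMap.le_opNorm _ _).trans ?_
    have h2 : ‖E b‖ ≤ ‖b‖ := by simpa using E.le_of_opNorm_le hE1 b
    gcongr
    exact h2

theorem restrict_surjective : Function.Surjective α.restrict := by
  obtain ⟨E, -, -, hEfix, hEcomp, -⟩ := α.exists_conditionalExpectation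
  intro φ
  obtain ⟨φ', hφ', -⟩ := exists_extension_norm_eq α.fixedPoints.toSubalgebra.toSubmodule φ
  refine ⟨⟨φ'.comp E, hEcomp φ'⟩, ?_⟩
  ext b
  change φ' (E b) = φ b
  rw [hEfix b b.2]
  exact hφ' b

theorem isErgodic_iff_existsUnique_invariant_state [Nontrivial B] :
    α.IsErgodic ↔ ∃! μ : StrongDual ℂ B, IsState μ ∧ α.IsInvariant μ := by
  obtain ⟨E, hE1, hEmem, hEfix, hEcomp, hEinv⟩ := α.exists_conditionalExpectation
  have hE_state : ∀ g : StrongDual ℂ B, IsUnitalContraction g → IsState (g.comp E) := by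
    intro g hg
    refine IsUnitalContraction.isState ⟨?_, ?_⟩
    · exact (g.opNorm_comp_le E).trans (mul_le_one₀ hg.1 (norm_nonneg _) hE1)
    · rw [ContinuousLinearMap.comp_apply, hEfix 1 (one_mem _), hg.2]
  constructor
  · intro herg
    obtain ⟨g, hg⟩ := exists_isUnitalContraction B
    refine ⟨g.comp E, ⟨hE_state g hg, hEcomp g⟩, fun μ ⟨hμ, hμinv⟩ => ?_⟩
    ext b
    -- both functionals read off the scalar `E b`
    obtain ⟨c, hc⟩ : E b ∈ {b | ∃ c : ℂ, b = c • (1 : B)} := herg ▸ hEmem b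
    rw [← hEinv μ hμinv, ContinuousLinearMap.comp_apply, ContinuousLinearMap.comp_apply, hc,
      map_smul, map_smul, hμ.2, hg.2]
  · rintro ⟨μ, -, huniq⟩
    refine Set.Subset.antisymm (fun b hb => ⟨μ b, ?_⟩) ?_
    · -- every state `g` of `B` agrees with `g ∘ E`, which is `μ`, on the fixed points
      refine sub_eq_zero.mp <| eq_zero_of_forall_isUnitalContraction fun g hg => ?_
      rw [← huniq (g.comp E) ⟨hE_state g hg, hEcomp g⟩, ContinuousLinearMap.comp_apply,
        hEfix b hb, map_sub, map_smul, hg.2, smul_eq_mul, mul_one, sub_self]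
    · rintro _ ⟨c, rfl⟩
      exact α.fixedPoints.smul_mem (one_mem _) c

end CompactQuantumGroup.Action
end

theorem mainTheorem3 {A : Type*} [CStarAlgebra A] {B : Type*} [CStarAlgebra B] [Nontrivial B]
    (G : CompactQuantumGroup A) (α : G.Action B) :
    (Isometry α.restrict ∧ Function.Bijective α.restrict) ∧
      (α.IsErgodic ↔ ∃! μ : StrongDual ℂ B, IsState μ ∧ α.IsInvariant μ) :=
  ⟨⟨α.restrict_isometry, α.restrict_isometry.injective, α.restrict_surjective⟩,
    α.isErgodic_iff_existsUnique_invariant_state⟩
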